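/- Let $\gamma:\mathbb{R}\to\mathbb{R}^2$ be a smooth ($C^\infty$) closed convex curve with strictly positive curvature, $2\pi$-periodic and parameterized so that $\gamma'(\theta)$ is a positive multiple of $(-\sin\theta,\cos\theta)$. Write $[w_1,w_2]$ for the determinant of the matrix with columns $w_1,w_2$. Let $u$ be a positive multiple of $\tfrac12(\gamma(\theta)-\gamma(\theta+\pi))$ (the unit circle of the Minkowski metric in which $\gamma$ has constant width), and let $v=u'/[u,u']$ be the dual unit circle; then $u=-v'/[v,v']$. A curve $X$ has constant $w$-width if $X(\theta)-X(\theta+\pi)=2c\,w(\theta)$ for a constant $c$. Define the involutes as follows. If $M'=\alpha u'$, then $\mathrm{Inv}(M)=M+\beta v$ with $\beta(\theta)=\tfrac12\int_\theta^{\theta+\pi}\alpha[u,u']\,ds$. If $N'=\beta v'$, then $\mathrm{Inv}(N)=N+\alpha u$ with $\alpha(\theta)=-\tfrac12\int_\theta^{\theta+\pi}\beta[v,v']\,ds$. Put $M_0(\theta)=\tfrac12(\gamma(\theta)+\gamma(\theta+\pi))$ (the area evolute of $\gamma$) and, for $i\ge 1$, $N_i=\mathrm{Inv}(M_{i-1})$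 and $M_i=\mathrm{Inv}(N_i)$. For a closed curve $X$ let $\overline X$ be the region bounded by $X$, that is, the complement of the set of points that can be reached from a point of $\gamma$ by a path that does not meet $X$. Then $\overline{M_0}\supset\overline{N_1}\supset\overline{M_1}\supset\overline{N_2}\supset\cdots$, the intersection of all these regions consists of a single point $O=O(\gamma)$, and the curves $M_i$ and $N_i$ converge in the $C^\infty$ topology (uniform convergence of the derivatives of every order in $\theta$) to the constant curve $O$. Moreover, for all real $c$ and $d$, the curves $M_i+cu$ have constant $u$-width, with constant $c$, the curves $N_i+dv$ have constant $v$-width, with constant $d$, and $M_i+cu$ and $N_i+dv$ converge in the $C^\infty$ topology to $O+cu$ and $O+dv$, respectively. -/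

import Mathlib

open scoped ContDiff Topology

noncomputable section

namespace MinkowskiPlane

/-- The plane `ℝ²`. -/
abbrev Plane := EuclideanSpace ℝ (Fin 2)

/-- `[w₁, w₂]`, the determinant of the matrix with columns `w₁` and `w₂`. -/
def bracket (w₁ w₂ : Plane) : ℝ := w₁ 0 * w₂ 1 - w₁ 1 * w₂ 0

/-- The unit vector `e_θ = (-sin θ, cos θ)`. -/
def eTheta (θ : ℝ) : Plane := !₂[-Real.sin θ, Real.cos θ]

/-- A smooth closed convex curve with strictly positive curvature, parameterized by `θ` so that
`γ'(θ)` is a positive multiple of `e_θ`; the multiple is the Euclidean radius of curvature.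
(Such a closed curve makes exactly one turn, so it is the boundary of a strictly convex region.) -/
structure IsConvexCurve (γ : ℝ → Plane) : Prop where
  smooth : ContDiff ℝ ∞ γ
  periodic : Function.Periodic γ (2 * Real.pi)
  tangent : ∀ θ, ∃ r : ℝ, 0 < r ∧ deriv γ θ = r • eTheta θ

/-- The area evolute of `γ`: the midpoints of the diameters (chords joining points with
parallel tangents). -/
def areaEvolute (γ : ℝ → Plane) (θ : ℝ) : Plane :=
  (1 / 2 : ℝ) • (γ θ + γ (θ + Real.pi))

/-- The boundary `u(γ)` of the central symmetrization of the region bounded by `γ`. -/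
def symmetrization (γ : ℝ → Plane) (θ : ℝ) : Plane :=
  (1 / 2 : ℝ) • (γ θ - γ (θ + Real.pi))

/-- The dual unit curve `v = w' / [w, w']` of a unit curve `w`. -/
def dualCurve (w : ℝ → Plane) (θ : ℝ) : Plane :=
  (bracket (w θ) (deriv w θ))⁻¹ • deriv w θ

/-- The Minkowski curvature radius of the curve `X` with respect to the unit curve `w`: the
function `r` with `X' = r w'`. -/
def curvatureRadius (w X : ℝ → Plane) (θ : ℝ) : ℝ :=
  bracket (w θ) (deriv X θ) / bracket (w θ) (deriv w θ)

/-- `curvatureRadius` is the proportionality factor between `X'` and `w'`. -/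
theorem curvatureRadius_eq {w X : ℝ → Plane} {θ r : ℝ}
    (hw : bracket (w θ) (deriv w θ) ≠ 0) (h : deriv X θ = r • deriv w θ) :
    curvatureRadius w X θ = r := by
  unfold curvatureRadius
  rw [h, div_eq_iff hw]
  simp only [bracket, PiLp.smul_apply, smul_eq_mul]
  ring

/-- The function `θ ↦ (1/2) ∫_θ^{θ+π} r [w, w'] ds`, where `X' = r w'`. -/
def involuteRadius (w X : ℝ → Plane) (θ : ℝ) : ℝ :=
  (1 / 2 : ℝ) *
    ∫ s in θ..(θ + Real.pi), curvatureRadius w X s * bracket (w s) (deriv w s)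

/-- The involute `Inv(X)` of a curve `X` with `X' = r w'`, with respect to the dual metric of `w`.
With `w = u` and dual `v` this is `M ↦ M + β v`, where `β = (1/2) ∫_θ^{θ+π} α [u, u'] ds`.
With `w = v`, whose dual curve is `-u`, it is `N ↦ N + α u`, where
`α = -(1/2) ∫_θ^{θ+π} β [v, v'] ds`. -/
def involute (w X : ℝ → Plane) (θ : ℝ) : Plane :=
  X θ + involuteRadius w X θ • dualCurve w θ

/-- The exterior of the curve `X`: the points that can be reached from a point of `γ` by a path
that does not meet `X`. -/
def exteriorOf (γ X : ℝ → Plane) : Set Plane :=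
  {p | ∃ q ∈ Set.range γ, JoinedIn (Set.range X)ᶜ q p}

/-- The region bounded by the curve `X`: the complement of its exterior. -/
def boundedRegion (γ X : ℝ → Plane) : Set Plane := (exteriorOf γ X)ᶜ

/-- `X` has constant `w`-width, with constant `c`. -/
def HasConstantWidth (w : ℝ → Plane) (c : ℝ) (X : ℝ → Plane) : Prop :=
  ∀ θ, X θ - X (θ + Real.pi) = (2 * c) • w θ

/-- Convergence of a sequence of (smooth, periodic) curves in the `C^∞` topology: uniform
convergence of the derivatives of every order. -/
def CInftyConverges (X : ℕ → ℝ → Plane) (Y : ℝ → Plane) : Prop :=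
  (∀ i, ContDiff ℝ ∞ (X i)) ∧ ContDiff ℝ ∞ Y ∧
    ∀ k : ℕ, TendstoUniformly (fun i => iteratedDeriv k (X i)) (iteratedDeriv k Y) Filter.atTop

end MinkowskiPlane

end

/-! Two arguments are combined, one topological for the nesting and one spectral for the
convergence.

Nesting. Let `X` be a `π`-periodic front with tangents parallel to `z`. For a point `x` put `f = [x
- X, z]`. It is antiperiodic, it vanishes exactly when `x` lies on the tangent line at `θ`, and `f'
= [x - X, z']` since `[X', z] = 0`. `crossSet z X` collects the `x` for which `f` changes sign once
per half period, transversally. If `Y = X + β z` is the involute and `w' = μ z`, then `[x - Y, -w]'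
= -μ f`, because the term along `z` drops out. Hence one sign change of `f` makes `[x - Y, -w]`
monotone on a half period, and it too changes sign once (`crossSet_subset_crossSet_involute`). By
convexity `γ` lies in the first cross set. A cross set is open, closed relative to the complement of
`X`, and path connected, so it is the exterior of `X` as soon as it contains `γ`
(`IsFront.exteriorOf_eq`). Thus exteriors increase and regions decrease.

Convergence. Let `A i`, `B i` be the curvature radii of `M i` and `N (i + 1)`, let `h` be the
support function of `u` and `μ = [u, u'] = h (h + h'')`; also `[v, v'] = 1 / h²`. Then `(B i)' = -μ
A i` and `(A (i + 1))' = B i / h²`, so each double step inverts the Sturm-Liouville operator `α ↦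
-(h² α')' / μ` on antiperiodic functions. Substituting `q = h α` turns `∫ (h² α'² - μ α²)` into `∫
(q'² - q²)`, and Wirtinger's inequality shows that the lowest eigenvalue is `1`, with eigenfunctions
`[c, v]`. Closedness of `M i` says that `A i` is orthogonal to these (`exists_spectral_gap`), so the
radii decay geometrically (`exists_geometric_decay`). The recursion passes the decay on to all
derivatives, and the steps `B i • v` and `A (i + 1) • u` are summable. -/

namespace MinkowskiPlane

open Set Filter

/-! ### Antiperiodic functions with one transversal sign change -/

/-- The antiperiodic function `f`, with derivative `f'`, changes sign exactly once in a half
period, and transversally. -/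
def CrossesOnce (f f' : ℝ → ℝ) : Prop :=
  ∃ θ₀, f θ₀ = 0 ∧ 0 < f' θ₀ ∧ ∀ θ ∈ Ioo θ₀ (θ₀ + Real.pi), 0 < f θ

/-- An antiperiodic function that decreases on a half period crosses once. -/
theorem CrossesOnce.of_deriv_neg {g g' : ℝ → ℝ} (hg : Function.Antiperiodic g Real.pi)
    (hd : ∀ θ, HasDerivAt g (g' θ) θ) {ψ : ℝ}
    (hneg : ∀ θ ∈ Ioo ψ (ψ + Real.pi), g' θ < 0) : CrossesOnce g g' := by
  have hpi := Real.pi_pos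
  have hg' : ∀ θ, g' (θ + Real.pi) = - g' θ := fun θ => by
    have h1 : HasDerivAt (fun t => g (t + Real.pi)) (g' (θ + Real.pi)) θ :=
      (hd (θ + Real.pi)).comp_add_const θ Real.pi
    have h2 : HasDerivAt (fun t => g (t + Real.pi)) (-g' θ) θ := by
      have : (fun t => g (t + Real.pi)) = fun t => - g t := funext hg
      rw [this]; exact (hd θ).neg
    exact h1.unique h2
  have hcont : Continuous g := continuous_iff_continuousAt.2 fun θ => (hd θ).continuousAt
  have hanti : StrictAntiOn g (Icc ψ (ψ + Real.pi)) :=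
    strictAntiOn_of_deriv_neg (convex_Icc _ _) hcont.continuousOn fun θ hθ => by
      rw [interior_Icc] at hθ
      rw [(hd θ).deriv]; exact hneg θ hθ
  have hlt : g (ψ + Real.pi) < g ψ :=
    hanti (left_mem_Icc.2 (by linarith)) (right_mem_Icc.2 (by linarith)) (by linarith)
  have hψ : 0 < g ψ := by rw [hg ψ] at hlt; linarith
  have hψ' : g (ψ + Real.pi) < 0 := by rw [hg ψ]; linarith
  obtain ⟨t, ht, ht0⟩ : (0 : ℝ) ∈ g '' Ioo ψ (ψ + Real.pi) :=
    intermediate_value_Ioo' (by linarith) hcont.continuousOn ⟨hψ', hψ⟩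
  -- The zero `t` is a downward crossing; the upward one lies half a period later.
  refine ⟨t + Real.pi, by rw [hg, ht0, neg_zero], by rw [hg']; linarith [hneg t ht], ?_⟩
  intro θ hθ
  obtain ⟨s, rfl⟩ : ∃ s, θ = s + Real.pi := ⟨θ - Real.pi, by ring⟩
  rw [hg]
  rcases le_or_gt s (ψ + Real.pi) with hs | hs
  · have := hanti (Ioo_subset_Icc_self ht) (show s ∈ Icc ψ (ψ + Real.pi) from
      ⟨by linarith [hθ.1, ht.1], hs⟩) (by linarith [hθ.1])
    linarith
  · obtain ⟨r, rfl⟩ : ∃ r, s = r + Real.pi := ⟨s - Real.pi, by ring⟩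
    rw [hg]
    have := hanti (show r ∈ Icc ψ (ψ + Real.pi) from ⟨by linarith, by linarith [hθ.2, ht.2]⟩)
      (Ioo_subset_Icc_self ht) (by linarith [hθ.2])
    linarith

theorem CrossesOnce.neg {f f' : ℝ → ℝ} (hf : Function.Antiperiodic f Real.pi)
    (hf' : Function.Antiperiodic f' Real.pi) (h : CrossesOnce f f') :
    CrossesOnce (fun θ => -f θ) (fun θ => -f' θ) := by
  obtain ⟨t, h0, h1, h2⟩ := h
  refine ⟨t + Real.pi, by simp [hf t, h0], by simpa [hf' t] using h1, fun θ hθ => ?_⟩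
  obtain ⟨s, rfl⟩ : ∃ s, θ = s + Real.pi := ⟨θ - Real.pi, by ring⟩
  simpa [hf s] using h2 s ⟨by linarith [hθ.1], by linarith [hθ.2]⟩

/-- Crossing once is an open condition in the `C¹` topology. -/
theorem CrossesOnce.exists_perturb {f f' : ℝ → ℝ} (hfd : ∀ θ, HasDerivAt f (f' θ) θ)
    (hf'c : Continuous f') (h : CrossesOnce f f') :
    ∃ ε > 0, ∀ g g' : ℝ → ℝ, Function.Antiperiodic g Real.pi →
      (∀ θ, HasDerivAt g (g' θ) θ) → (∀ θ, |g θ - f θ| < ε) → (∀ θ, |g' θ - f' θ| < ε) →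
      CrossesOnce g g' := by
  obtain ⟨t, h0, h1, h2⟩ := h
  have hpi := Real.pi_pos
  have hcont : Continuous f := continuous_iff_continuousAt.2 fun θ => (hfd θ).continuousAt
  obtain ⟨δ₀, hδ₀, hball⟩ : ∃ δ > 0, ∀ s, |s - t| < δ → f' t / 2 < f' s := by
    have := (hf'c.tendsto t).eventually (lt_mem_nhds (half_lt_self h1))
    obtain ⟨δ, hδ, H⟩ := Metric.eventually_nhds_iff.1 this
    exact ⟨δ, hδ, fun s hs => H (by simpa [Real.dist_eq] using hs)⟩
  set δ := min (δ₀ / 2) (Real.pi / 4) with hδdef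
  have hδ : 0 < δ := by positivity
  have hδ1 : δ < δ₀ := (min_le_left _ _).trans_lt (by linarith)
  have hδ2 : δ ≤ Real.pi / 4 := min_le_right _ _
  have hder : ∀ s ∈ Icc (t - δ) (t + δ), f' t / 2 < f' s := fun s hs =>
    hball s (by rw [abs_lt]; constructor <;> linarith [hs.1, hs.2])
  have hmono : StrictMonoOn f (Icc (t - δ) (t + δ)) :=
    strictMonoOn_of_deriv_pos (convex_Icc _ _) hcont.continuousOn fun θ hθ => by
      rw [interior_Icc] at hθ
      rw [(hfd θ).deriv]
      linarith [hder θ (Ioo_subset_Icc_self hθ)]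
  have hneg : f (t - δ) < 0 := by
    rw [← h0]
    exact hmono ⟨le_rfl, by linarith⟩ ⟨by linarith, by linarith⟩ (by linarith)
  have hcpt : IsCompact (Icc (t + δ) (t + Real.pi - δ)) := isCompact_Icc
  obtain ⟨m, hm, hmin⟩ := hcpt.exists_isMinOn (nonempty_Icc.2 (by linarith)) hcont.continuousOn
  have hmpos : 0 < f m := h2 m ⟨by linarith [hm.1], by linarith [hm.2]⟩
  -- The three bounds keep, in this order, monotonicity near `t`, the negative sign at `t - δ`, and
  -- positivity on the middle interval.
  refine ⟨min (f' t / 2) (min (-f (t - δ)) (f m)), by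
    have : 0 < -f (t - δ) := by linarith
    positivity, fun g g' hga hgd hg hg' => ?_⟩
  have hgc : Continuous g := continuous_iff_continuousAt.2 fun θ => (hgd θ).continuousAt
  have hg'pos : ∀ s ∈ Icc (t - δ) (t + δ), 0 < g' s := fun s hs => by
    have a1 := hder s hs
    have a2 := (hg' s).trans_le (min_le_left _ _)
    rw [abs_lt] at a2; linarith
  have hgm : ∀ s ∈ Icc (t + δ) (t + Real.pi - δ), 0 < g s := fun s hs => by
    have a1 : f m ≤ f s := hmin hs
    have a2 := (hg s).trans_le ((min_le_right _ _).trans (min_le_right _ _))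
    rw [abs_lt] at a2; linarith
  have hgneg : g (t - δ) < 0 := by
    have a2 := (hg (t - δ)).trans_le ((min_le_right _ _).trans (min_le_left _ _))
    rw [abs_lt] at a2; linarith
  have hgmono : StrictMonoOn g (Icc (t - δ) (t + δ)) :=
    strictMonoOn_of_deriv_pos (convex_Icc _ _) hgc.continuousOn fun θ hθ => by
      rw [interior_Icc] at hθ
      rw [(hgd θ).deriv]
      exact hg'pos θ (Ioo_subset_Icc_self hθ)
  have hgpos : 0 < g (t + δ) := hgm _ ⟨le_rfl, by linarith⟩
  obtain ⟨r, hr, hr0⟩ : (0 : ℝ) ∈ g '' Ioo (t - δ) (t + δ) :=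
    intermediate_value_Ioo (by linarith) hgc.continuousOn ⟨hgneg, hgpos⟩
  refine ⟨r, hr0, hg'pos r (Ioo_subset_Icc_self hr), fun s hs => ?_⟩
  rcases le_or_gt s (t + δ) with h3 | h3
  · have := hgmono (Ioo_subset_Icc_self hr) (show s ∈ Icc (t - δ) (t + δ) from
      ⟨by linarith [hs.1, hr.1], h3⟩) hs.1
    linarith
  rcases le_or_gt s (t + Real.pi - δ) with h4 | h4
  · exact hgm s ⟨h3.le, h4⟩
  · obtain ⟨q, rfl⟩ : ∃ q, s = q + Real.pi := ⟨s - Real.pi, by ring⟩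
    have := hgmono (show q ∈ Icc (t - δ) (t + δ) from
      ⟨by linarith, by linarith [hs.2, hr.2]⟩) (Ioo_subset_Icc_self hr) (by linarith [hs.2])
    rw [hga]; linarith

/-- A `C¹` limit of functions that cross once, all of whose zeros are simple, crosses once. -/
theorem CrossesOnce.of_tendsto {f f' : ℝ → ℝ} {F F' : ℕ → ℝ → ℝ}
    (hfd : ∀ θ, HasDerivAt f (f' θ) θ) (hf'c : Continuous f')
    (hFa : ∀ n, Function.Antiperiodic (F n) Real.pi)
    (hFa' : ∀ n, Function.Antiperiodic (F' n) Real.pi)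
    (hF : TendstoUniformly F f atTop) (hF' : TendstoUniformly F' f' atTop)
    (hcr : ∀ n, CrossesOnce (F n) (F' n)) (hsimple : ∀ θ, f θ = 0 → f' θ ≠ 0) :
    CrossesOnce f f' := by
  have hpi := Real.pi_pos
  have hcont : Continuous f := continuous_iff_continuousAt.2 fun θ => (hfd θ).continuousAt
  have hper : ∀ {g : ℝ → ℝ} (hg : Function.Antiperiodic g Real.pi) (θ : ℝ) (n : ℤ),
      g (θ + n • (2 * Real.pi)) = g θ := fun hg θ n => hg.periodic_two_mul.zsmul n θ
  have hcr' : ∀ n, ∃ t ∈ Icc 0 (2 * Real.pi), F n t = 0 ∧ 0 < F' n t ∧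
      ∀ θ ∈ Ioo t (t + Real.pi), 0 < F n θ := fun n => by
    obtain ⟨t, h0, h1, h2⟩ := hcr n
    -- Crossing parameters are moved into one period so that a subsequence converges.
    obtain ⟨k, hk, -⟩ := existsUnique_add_zsmul_mem_Ico (show 0 < 2 * Real.pi by linarith) t 0
    refine ⟨t + k • (2 * Real.pi), ⟨hk.1, by linarith [hk.2]⟩, ?_, ?_, fun θ hθ => ?_⟩
    · rw [hper (hFa n), h0]
    · rwa [hper (hFa' n)]
    · have := h2 (θ - k • (2 * Real.pi)) ⟨by linarith [hθ.1], by linarith [hθ.2]⟩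
      rw [← hper (hFa n) _ k] at this
      simpa using this
  choose t ht h0 h1 h2 using hcr'
  obtain ⟨T, -, φ, hφ, hT⟩ := isCompact_Icc.tendsto_subseq ht
  have hFφ := fun ψ : ℕ → ℝ => fun s (hψ : Tendsto ψ atTop (𝓝 s)) =>
    TendstoUniformly.tendsto_comp (f := f) (fun u hu => hφ.tendsto_atTop.eventually (hF u hu))
      hcont.continuousAt hψ
  have hF'φ := fun ψ : ℕ → ℝ => fun s (hψ : Tendsto ψ atTop (𝓝 s)) =>
    TendstoUniformly.tendsto_comp (f := f') (fun u hu => hφ.tendsto_atTop.eventually (hF' u hu))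
      hf'c.continuousAt hψ
  have e0 : f T = 0 := by
    refine tendsto_nhds_unique (hFφ _ _ hT) ?_
    simp [h0]
  have e1 : 0 ≤ f' T := ge_of_tendsto' (hF'φ _ _ hT) fun n => (h1 (φ n)).le
  have e2 : ∀ θ ∈ Ioo T (T + Real.pi), 0 ≤ f θ := fun θ hθ => by
    refine ge_of_tendsto (hFφ (fun _ => θ) θ tendsto_const_nhds) ?_
    have a1 := hT.eventually (gt_mem_nhds hθ.1)
    have a2 := hT.eventually (lt_mem_nhds (show θ - Real.pi < T by linarith [hθ.2]))
    filter_upwards [a1, a2] with n b1 b2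
    exact (h2 (φ n) θ ⟨b1, by simp at b2; linarith⟩).le
  -- The limit only gives weak inequalities. Simplicity of zeros makes them strict: an interior zero
  -- would be a local minimum, hence a double zero.
  refine ⟨T, e0, lt_of_le_of_ne e1 (hsimple T e0).symm, fun θ hθ => ?_⟩
  refine lt_of_le_of_ne (e2 θ hθ) fun h => ?_
  have hmin : IsLocalMin f θ := by
    filter_upwards [Ioo_mem_nhds hθ.1 hθ.2] with s hs
    rw [← h]; exact e2 s hs
  exact hsimple θ h.symm (hmin.hasDerivAt_eq_zero (hfd θ))

/-! ### Algebra and calculus of the bracket -/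

section Bracket

@[simp] theorem bracket_self (a : Plane) : bracket a a = 0 := by simp [bracket]; ring
theorem bracket_swap (a b : Plane) : bracket a b = -bracket b a := by simp [bracket]; ring
@[simp] theorem bracket_add_left (a b c : Plane) :
    bracket (a + b) c = bracket a c + bracket b c := by simp [bracket]; ring
@[simp] theorem bracket_sub_left (a b c : Plane) :
    bracket (a - b) c = bracket a c - bracket b c := by simp [bracket]; ring
@[simp] theorem bracket_smul_left (t : ℝ) (a b : Plane) :
    bracket (t • a) b = t * bracket a b := by simp [bracket]; ring
@[simp] theorem bracket_smul_right (t : ℝ) (a b : Plane) :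
    bracket a (t • b) = t * bracket a b := by simp [bracket]; ring
@[simp] theorem bracket_neg_left (a b : Plane) : bracket (-a) b = -bracket a b := by
  simp [bracket]; ring
@[simp] theorem bracket_neg_right (a b : Plane) : bracket a (-b) = -bracket a b := by
  simp [bracket]; ring
@[simp] theorem bracket_zero_left (a : Plane) : bracket 0 a = 0 := by simp [bracket]

/-- Cramer's rule. -/
theorem bracket_smul_sub_bracket_smul (a b c : Plane) :
    bracket a c • b - bracket b c • a = bracket a b • c := by
  ext i; fin_cases i <;> simp [bracket] <;> ring

theorem eq_zero_of_bracket_eq_zero {a b c : Plane} (hab : bracket a b ≠ 0)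
    (ha : bracket c a = 0) (hb : bracket c b = 0) : c = 0 := by
  have h := bracket_smul_sub_bracket_smul a b c
  rw [bracket_swap a c, bracket_swap b c, ha, hb] at h
  simpa [hab] using h.symm

/-- A vector parallel to `b ≠ 0` is a multiple of `b`. -/
theorem exists_eq_smul_of_bracket_eq_zero {a b c : Plane} (hab : bracket a b ≠ 0)
    (hc : bracket c b = 0) : c = (bracket a c / bracket a b) • b := by
  have h := bracket_smul_sub_bracket_smul a b c
  rw [bracket_swap b c, hc, neg_zero, zero_smul, sub_zero] at h
  rw [div_eq_inv_mul, mul_smul, h, smul_smul, inv_mul_cancel₀ hab, one_smul]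

theorem abs_bracket_le (a b : Plane) : |bracket a b| ≤ 2 * ‖a‖ * ‖b‖ := by
  have ha := fun i => PiLp.norm_apply_le a i
  have hb := fun i => PiLp.norm_apply_le b i
  simp only [Real.norm_eq_abs] at ha hb
  have h1 : |a 0 * b 1| ≤ ‖a‖ * ‖b‖ := by
    rw [abs_mul]; exact mul_le_mul (ha 0) (hb 1) (abs_nonneg _) (norm_nonneg _)
  have h2 : |a 1 * b 0| ≤ ‖a‖ * ‖b‖ := by
    rw [abs_mul]; exact mul_le_mul (ha 1) (hb 0) (abs_nonneg _) (norm_nonneg _)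
  have := abs_sub (a 0 * b 1) (a 1 * b 0)
  unfold bracket
  linarith

theorem _root_.HasDerivAt.bracket {X Z : ℝ → Plane} {X' Z' : Plane} {t : ℝ}
    (hX : HasDerivAt X X' t) (hZ : HasDerivAt Z Z' t) :
    HasDerivAt (fun s => bracket (X s) (Z s)) (bracket X' (Z t) + bracket (X t) Z') t := by
  have hc : ∀ {Y : ℝ → Plane} {Y' : Plane}, HasDerivAt Y Y' t → ∀ i,
      HasDerivAt (fun s => Y s i) (Y' i) t := fun hY i =>
    (EuclideanSpace.proj i : Plane →L[ℝ] ℝ).hasFDerivAt.comp_hasDerivAt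
      t hY
  have := ((hc hX 0).mul (hc hZ 1)).sub ((hc hX 1).mul (hc hZ 0))
  refine this.congr_deriv ?_
  simp only [MinkowskiPlane.bracket]; ring

theorem _root_.ContDiff.bracket {n : WithTop ℕ∞} {X Z : ℝ → Plane}
    (hX : ContDiff ℝ n X) (hZ : ContDiff ℝ n Z) :
    ContDiff ℝ n (fun s => bracket (X s) (Z s)) := by
  have hX' := contDiff_euclidean.1 hX
  have hZ' := contDiff_euclidean.1 hZ
  exact ((hX' 0).mul (hZ' 1)).sub ((hX' 1).mul (hZ' 0))

theorem _root_.Continuous.bracket {X Z : ℝ → Plane} (hX : Continuous X) (hZ : Continuous Z) :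
    Continuous (fun s => bracket (X s) (Z s)) :=
  contDiff_zero.1 ((contDiff_zero.2 hX).bracket (contDiff_zero.2 hZ))

end Bracket

/-! ### Smooth and periodic functions -/

section Smooth

variable {E : Type*} [NormedAddCommGroup E] [NormedSpace ℝ E]

theorem _root_.ContDiff.hasDerivAt_deriv {f : ℝ → E} (hf : ContDiff ℝ ∞ f) (t : ℝ) :
    HasDerivAt f (deriv f t) t :=
  (hf.differentiable (by simp)).differentiableAt.hasDerivAt

theorem _root_.ContDiff.deriv_infty {f : ℝ → E} (hf : ContDiff ℝ ∞ f) :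
    ContDiff ℝ ∞ (deriv f) := by
  exact (contDiff_infty_iff_deriv.1 hf).2

theorem _root_.Function.Antiperiodic.deriv {f : ℝ → E} {c : ℝ} (hf : Function.Antiperiodic f c) :
    Function.Antiperiodic (deriv f) c := fun t => by
  rw [← deriv_comp_add_const, show (fun s => f (s + c)) = -f from funext hf, deriv.neg']

theorem _root_.Function.Periodic.deriv_of_periodic {f : ℝ → E} {c : ℝ}
    (hf : Function.Periodic f c) : Function.Periodic (deriv f) c := fun t => by
  rw [← deriv_comp_add_const, show (fun s => f (s + c)) = f from funext hf]

end Smooth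

theorem exists_norm_le_of_periodic {E : Type*} [NormedAddCommGroup E] {f : ℝ → E}
    (hc : Continuous f) {c : ℝ} (hc0 : 0 < c) (hf : Function.Periodic f c) :
    ∃ C, 0 < C ∧ ∀ t, ‖f t‖ ≤ C := by
  obtain ⟨C, hC⟩ := (isCompact_Icc (a := 0) (b := c)).exists_bound_of_continuousOn hc.continuousOn
  refine ⟨max C 1, by positivity, fun t => ?_⟩
  obtain ⟨s, hs, h⟩ := hf.exists_mem_Ico₀ hc0 t
  rw [h]; exact (hC s (Ico_subset_Icc_self hs)).trans (le_max_left _ _)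


/-! ### Fronts and their exteriors -/

/-- A closed front `X`, `π`-periodic, whose tangent at `θ` is parallel to `z θ`, where `z` is a
centrally symmetric convex curve winding once around the origin. -/
structure IsFront (z X : ℝ → Plane) : Prop where
  smooth : ContDiff ℝ ∞ X
  smooth_dir : ContDiff ℝ ∞ z
  periodic : Function.Periodic X Real.pi
  antiperiodic_dir : Function.Antiperiodic z Real.pi
  tangent : ∀ θ, bracket (deriv X θ) (z θ) = 0
  pos : ∀ θ, 0 < bracket (z θ) (deriv z θ)
  crosses : ∀ c ≠ 0, CrossesOnce (fun θ => bracket c (z θ)) (fun θ => bracket c (deriv z θ))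

/-- The points `x` that lie on exactly one tangent line of the front `X`, not at the point of
tangency. -/
def crossSet (z X : ℝ → Plane) : Set Plane :=
  {x | CrossesOnce (fun θ => bracket (x - X θ) (z θ)) (fun θ => bracket (x - X θ) (deriv z θ))}

namespace IsFront

variable {z X : ℝ → Plane}

/-- The scale `σ` treats points of the plane (`σ = 1`) and directions at infinity (`σ = 0`) in one
family. The derivative of `X` drops out because `X'` is parallel to `z`. -/
theorem hasDerivAt (h : IsFront z X) (c : Plane) (σ θ : ℝ) :
    HasDerivAt (fun θ => bracket (c - σ • X θ) (z θ)) (bracket (c - σ • X θ) (deriv z θ)) θ := by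
  have h1 := ((hasDerivAt_const θ c).sub ((h.smooth.hasDerivAt_deriv θ).const_smul σ)).bracket
    (h.smooth_dir.hasDerivAt_deriv θ)
  refine h1.congr_deriv ?_
  simp [h.tangent θ]

theorem antiperiodic (h : IsFront z X) (c : Plane) (σ : ℝ) :
    Function.Antiperiodic (fun θ => bracket (c - σ • X θ) (z θ)) Real.pi := fun θ => by
  simp [h.periodic θ, h.antiperiodic_dir θ]

theorem antiperiodic' (h : IsFront z X) (c : Plane) (σ : ℝ) :
    Function.Antiperiodic (fun θ => bracket (c - σ • X θ) (deriv z θ)) Real.pi := fun θ => by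
  simp [h.periodic θ, h.antiperiodic_dir.deriv θ]

theorem continuous' (h : IsFront z X) (c : Plane) (σ : ℝ) :
    Continuous (fun θ => bracket (c - σ • X θ) (deriv z θ)) :=
  (continuous_const.sub (h.smooth.continuous.const_smul σ)).bracket
    h.smooth_dir.deriv_infty.continuous

theorem exists_bound (h : IsFront z X) : ∃ C, 0 < C ∧ ∀ θ,
    ‖X θ‖ ≤ C ∧ ‖z θ‖ ≤ C ∧ ‖deriv z θ‖ ≤ C := by
  obtain ⟨C₁, h₁, H₁⟩ := exists_norm_le_of_periodic h.smooth.continuous Real.pi_pos h.periodic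
  obtain ⟨C₂, h₂, H₂⟩ := exists_norm_le_of_periodic h.smooth_dir.continuous Real.two_pi_pos
    h.antiperiodic_dir.periodic_two_mul
  obtain ⟨C₃, h₃, H₃⟩ := exists_norm_le_of_periodic h.smooth_dir.deriv_infty.continuous
    Real.two_pi_pos h.antiperiodic_dir.deriv.periodic_two_mul
  refine ⟨C₁ + C₂ + C₃, by positivity, fun θ => ⟨?_, ?_, ?_⟩⟩
  · linarith [H₁ θ]
  · linarith [H₂ θ]
  · linarith [H₃ θ]

theorem eventually_crossesOnce (h : IsFront z X) {σ₀ : ℝ} {c₀ : Plane}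
    (h0 : CrossesOnce (fun θ => bracket (c₀ - σ₀ • X θ) (z θ))
      (fun θ => bracket (c₀ - σ₀ • X θ) (deriv z θ))) :
    ∀ᶠ p : ℝ × Plane in 𝓝 (σ₀, c₀), CrossesOnce (fun θ => bracket (p.2 - p.1 • X θ) (z θ))
      (fun θ => bracket (p.2 - p.1 • X θ) (deriv z θ)) := by
  obtain ⟨ε, hε, H⟩ := h0.exists_perturb (h.hasDerivAt c₀ σ₀) (h.continuous' c₀ σ₀)
  obtain ⟨C, hC, hb⟩ := h.exists_bound
  have hlim : Tendsto (fun p : ℝ × Plane => 2 * (‖p.2 - c₀‖ + |p.1 - σ₀| * C) * C)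
      (𝓝 (σ₀, c₀)) (𝓝 0) := by
    have : Continuous (fun p : ℝ × Plane => 2 * (‖p.2 - c₀‖ + |p.1 - σ₀| * C) * C) := by fun_prop
    simpa using this.tendsto (σ₀, c₀)
  filter_upwards [hlim.eventually (gt_mem_nhds hε)] with p hp
  have key : ∀ (θ : ℝ) (w : Plane), ‖w‖ ≤ C →
      |bracket (p.2 - p.1 • X θ) w - bracket (c₀ - σ₀ • X θ) w| < ε := fun θ w hw => by
    refine lt_of_le_of_lt ?_ hp
    rw [← bracket_sub_left]
    refine (abs_bracket_le _ _).trans ?_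
    have : ‖p.2 - p.1 • X θ - (c₀ - σ₀ • X θ)‖ ≤ ‖p.2 - c₀‖ + |p.1 - σ₀| * C := by
      rw [show p.2 - p.1 • X θ - (c₀ - σ₀ • X θ) = (p.2 - c₀) - (p.1 - σ₀) • X θ by module]
      refine (norm_sub_le _ _).trans ?_
      rw [norm_smul, Real.norm_eq_abs]
      gcongr
      exact (hb θ).1
    gcongr
  exact H _ _ (h.antiperiodic _ _) (h.hasDerivAt _ _) (fun θ => key θ _ (hb θ).2.1)
    (fun θ => key θ _ (hb θ).2.2)

theorem isOpen_crossSet (h : IsFront z X) : IsOpen (crossSet z X) := by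
  rw [isOpen_iff_mem_nhds]
  intro x hx
  have h1 : Tendsto (fun y : Plane => ((1 : ℝ), y)) (𝓝 x) (𝓝 (1, x)) :=
    (Continuous.prodMk_right (1 : ℝ)).tendsto x
  have := h1.eventually (h.eventually_crossesOnce (σ₀ := 1) (c₀ := x)
    (by simp only [one_smul]; exact hx))
  simp only [one_smul] at this
  exact this

/-- At a parameter where `x = X θ` both the function and its derivative vanish. Moved into `[t, t +
π)`, this contradicts transversality at `t` or positivity after it. -/
theorem disjoint_range (h : IsFront z X) {x : Plane} (hx : x ∈ crossSet z X) : x ∉ range X := by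
  rintro ⟨θ, rfl⟩
  obtain ⟨t, h0, h1, h2⟩ := hx
  obtain ⟨n, hn, -⟩ := existsUnique_add_zsmul_mem_Ico Real.pi_pos θ t
  have hX : X (θ + n • Real.pi) = X θ := h.periodic.zsmul n θ
  rw [← hX] at h0 h1 h2
  rcases hn.1.eq_or_lt with h3 | h3
  · rw [← h3] at h1; simp at h1
  · have := h2 _ ⟨h3, hn.2⟩
    simp at this

/-- Off `X` all zeros are simple: `z` and `z'` are independent, so a double zero forces `x = X θ`.
Simplicity lets the sign pattern survive limits. -/
theorem closure_crossSet_inter_subset (h : IsFront z X) :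
    closure (crossSet z X) ∩ (range X)ᶜ ⊆ crossSet z X := by
  rintro x ⟨hx, hxX⟩
  obtain ⟨y, hy, hlim⟩ := mem_closure_iff_seq_limit.1 hx
  obtain ⟨C, hC, hb⟩ := h.exists_bound
  have key : ∀ w : ℝ → Plane, (∀ θ, ‖w θ‖ ≤ C) →
      TendstoUniformly (fun n θ => bracket (y n - X θ) (w θ)) (fun θ => bracket (x - X θ) (w θ))
        atTop := fun w hw => by
    rw [Metric.tendstoUniformly_iff]
    intro ε hε
    have h1 : Tendsto (fun n => 2 * ‖x - y n‖ * C) atTop (𝓝 0) := by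
      have := ((tendsto_const_nhds (x := x)).sub hlim).norm.const_mul 2 |>.mul_const C
      simpa using this
    filter_upwards [h1.eventually (gt_mem_nhds hε)] with n hn θ
    rw [Real.dist_eq, ← bracket_sub_left, sub_sub_sub_cancel_right]
    refine ((abs_bracket_le _ _).trans ?_).trans_lt hn
    gcongr
    exact hw θ
  refine CrossesOnce.of_tendsto ?_ ?_ ?_ ?_ (key z fun θ => (hb θ).2.1)
    (key (deriv z) fun θ => (hb θ).2.2) hy fun θ h0 h1 => hxX ⟨θ, ?_⟩
  · simpa only [one_smul] using h.hasDerivAt x 1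
  · simpa only [one_smul] using h.continuous' x 1
  · intro n; simpa only [one_smul] using h.antiperiodic (y n) 1
  · intro n; simpa only [one_smul] using h.antiperiodic' (y n) 1
  · exact (sub_eq_zero.1 (eq_zero_of_bracket_eq_zero (h.pos θ).ne' h0 h1)).symm

/-- One can leave along the tangent line through `x`: moving in direction `z t` adds a nonnegative
multiple of `[z t, z θ]`, which has the same zero and the same sign pattern. -/
theorem exists_ray (h : IsFront z X) {x : Plane} (hx : x ∈ crossSet z X) :
    ∃ c ≠ 0, ∀ s : ℝ, 0 ≤ s → x + s • c ∈ crossSet z X := by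
  obtain ⟨t, h0, h1, h2⟩ := hx
  have hzt := h.pos t
  have hz : z t ≠ 0 := fun h0 => by simp [h0] at hzt
  refine ⟨z t, hz, fun s hs => ⟨t, ?_, ?_, fun θ hθ => ?_⟩⟩
  · simp only [add_sub_right_comm, bracket_add_left, bracket_smul_left, bracket_self, h0]; simp
  · simp only [add_sub_right_comm, bracket_add_left, bracket_smul_left]
    have := mul_nonneg hs hzt.le
    linarith
  -- The crossing of `[z t, ·]` is at `t` modulo `π`, and the sign of the derivative excludes odd
  -- multiples of `π`.
  · have h3 : 0 < bracket (z t) (z θ) := by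
      obtain ⟨r, hr0, hr1, hr2⟩ := h.crosses (z t) hz
      have hpi := Real.pi_pos
      have hanti : Function.Antiperiodic (fun θ => bracket (z t) (z θ)) Real.pi := fun θ => by
        simp [h.antiperiodic_dir θ]
      have hanti' : Function.Antiperiodic (fun θ => bracket (z t) (deriv z θ)) Real.pi :=
        fun θ => by simp [h.antiperiodic_dir.deriv θ]
      obtain ⟨n, hn, -⟩ := existsUnique_add_zsmul_mem_Ico hpi t r
      have e1 := hanti.add_zsmul_eq (x := t) n
      simp only [bracket_self, smul_zero] at e1
      have e2 : t + n • Real.pi = r := by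
        rcases hn.1.eq_or_lt with h3 | h3
        · exact h3.symm
        · have := hr2 _ ⟨h3, hn.2⟩
          simp only at this; linarith
      rw [← e2] at hr1 hr2
      have e3 := hanti'.add_zsmul_eq (x := t) n
      have e4 := hanti.add_zsmul_eq (x := θ) n
      simp only at e3 e4 hr1 hr2
      have e5 := hr2 (θ + n • Real.pi) ⟨by linarith [hθ.1], by linarith [hθ.2]⟩
      rw [e3] at hr1
      rw [e4] at e5
      rcases Int.even_or_odd n with hn' | hn'
      · simpa [Int.negOnePow_even _ hn'] using e5
      · rw [Int.negOnePow_odd _ hn'] at hr1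
        simp at hr1; linarith
    have := mul_nonneg hs h3.le
    have h4 := h2 θ hθ
    simp only [add_sub_right_comm, bracket_add_left, bracket_smul_left]
    linarith

/-- After division by `‖x‖`, the function of a distant point is a small perturbation of `[c, z]`
with `‖c‖ = 1`; compactness of the unit circle makes this uniform. -/
theorem exists_norm_le_mem_crossSet (h : IsFront z X) :
    ∃ R, 0 < R ∧ ∀ x : Plane, R ≤ ‖x‖ → x ∈ crossSet z X := by
  have hev := (isCompact_sphere (0 : Plane) 1).eventually_forall_of_forall_eventually
    (x₀ := (0 : ℝ)) (P := fun σ c => CrossesOnce (fun θ => bracket (c - σ • X θ) (z θ))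
      (fun θ => bracket (c - σ • X θ) (deriv z θ))) fun c hc => h.eventually_crossesOnce (by
        simp only [zero_smul, sub_zero]
        exact h.crosses c (by rintro rfl; simp at hc))
  obtain ⟨ε, hε, H⟩ := Metric.eventually_nhds_iff.1 hev
  refine ⟨2 / ε, by positivity, fun x hx => ?_⟩
  have hx0 : 0 < ‖x‖ := lt_of_lt_of_le (by positivity) hx
  have hlt : ‖x‖⁻¹ < ε := by
    rw [inv_lt_comm₀ hx0 hε]
    refine lt_of_lt_of_le ?_ hx
    rw [lt_div_iff₀ hε, inv_mul_cancel₀ hε.ne']; norm_num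
  obtain ⟨t, h0, h1, h2⟩ := H (y := ‖x‖⁻¹) (by
    rw [Real.dist_eq, sub_zero, abs_of_pos (by positivity)]; exact hlt) (‖x‖⁻¹ • x) (by
    simp [norm_smul, hx0.ne'])
  simp only [← smul_sub, bracket_smul_left] at h0 h1 h2
  have hi : 0 < ‖x‖⁻¹ := by positivity
  exact ⟨t, (mul_eq_zero.1 h0).resolve_left hi.ne', pos_of_mul_pos_right h1 hi.le,
    fun θ hθ => pos_of_mul_pos_right (h2 θ hθ) hi.le⟩

/-- Follow a ray out of the disc of radius `R`, return radially to its boundary circle, and go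
around the circle. -/
theorem joinedIn_crossSet (h : IsFront z X) {x y : Plane} (hx : x ∈ crossSet z X)
    (hy : y ∈ crossSet z X) : JoinedIn (crossSet z X) x y := by
  obtain ⟨R, hR, H⟩ := h.exists_norm_le_mem_crossSet
  have key : ∀ x ∈ crossSet z X, ∃ p ∈ Metric.sphere (0 : Plane) R,
      JoinedIn (crossSet z X) x p := by
    intro x hx
    obtain ⟨c, hc, hray⟩ := h.exists_ray hx
    have hc' : 0 < ‖c‖ := norm_pos_iff.2 hc
    set S := (R + ‖x‖) / ‖c‖ with hS
    have hS0 : 0 ≤ S := by positivity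
    have hq : R ≤ ‖x + S • c‖ := by
      have h1 : ‖S • c‖ = R + ‖x‖ := by
        rw [norm_smul, Real.norm_of_nonneg hS0, hS, div_mul_cancel₀ _ hc'.ne']
      have h2 := norm_sub_norm_le (S • c) (-x)
      rw [norm_neg, sub_neg_eq_add, add_comm (S • c)] at h2
      linarith
    set q := x + S • c with hqdef
    have hq0 : 0 < ‖q‖ := hR.trans_le hq
    refine ⟨(R / ‖q‖) • q, by simp [norm_smul, hq0.ne', abs_of_pos hR], ?_⟩
    refine JoinedIn.trans (y := q) (JoinedIn.of_segment_subset ?_) (JoinedIn.of_segment_subset ?_)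
    · rw [segment_eq_image']
      rintro _ ⟨t, ht, rfl⟩
      simp only [hqdef, add_sub_cancel_left, smul_smul]
      exact hray _ (mul_nonneg ht.1 hS0)
    · rw [segment_eq_image']
      rintro _ ⟨t, ht, rfl⟩
      refine H _ ?_
      beta_reduce
      have hle : R / ‖q‖ ≤ 1 := (div_le_one hq0).2 hq
      rw [show q + t • ((R / ‖q‖) • q - q) = (1 + t * (R / ‖q‖ - 1)) • q by module, norm_smul]
      have h5 : R / ‖q‖ ≤ 1 + t * (R / ‖q‖ - 1) := by nlinarith [ht.1, ht.2]
      have h6 : 0 < R / ‖q‖ := by positivity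
      rw [Real.norm_of_nonneg (h6.le.trans h5)]
      calc R = R / ‖q‖ * ‖q‖ := by field_simp
        _ ≤ _ := by gcongr
  obtain ⟨p, hp, hxp⟩ := key x hx
  obtain ⟨q, hq, hyq⟩ := key y hy
  have hrank : 1 < Module.rank ℝ Plane := by
    rw [← Module.finrank_eq_rank]; simp
  refine (hxp.trans ?_).trans hyq.symm
  refine ((isPathConnected_sphere hrank 0 hR.le).joinedIn p hp q hq).mono fun w hw => H w ?_
  rw [mem_sphere_zero_iff_norm.1 hw]

/-- A path avoiding `X` cannot leave the cross set, which is open and closed off `X`; conversely the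
cross set is path connected and avoids `X`. -/
theorem exteriorOf_eq (h : IsFront z X) {γ : ℝ → Plane} (hγ : range γ ⊆ crossSet z X) :
    exteriorOf γ X = crossSet z X := by
  have hsub : crossSet z X ⊆ (range X)ᶜ := fun x hx => h.disjoint_range hx
  ext p
  constructor
  · rintro ⟨q, hq, path⟩
    obtain ⟨c, hc⟩ := path
    have hpre : IsPreconnected (range c) := isPreconnected_range c.continuous
    have := hpre.subset_of_closure_inter_subset h.isOpen_crossSet
      ⟨q, ⟨0, c.source⟩, hγ hq⟩ fun x hx => h.closure_crossSet_inter_subset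
        ⟨hx.1, by obtain ⟨t, rfl⟩ := hx.2; exact hc t⟩
    exact this ⟨1, c.target⟩
  · intro hp
    exact ⟨γ 0, mem_range_self 0, (h.joinedIn_crossSet (hγ (mem_range_self 0)) hp).mono hsub⟩

end IsFront

/-! ### Half-period integrals -/

theorem hasDerivAt_half_integral {p : ℝ → ℝ} (hp : Continuous p)
    (ha : Function.Antiperiodic p Real.pi) (θ : ℝ) :
    HasDerivAt (fun θ => (1 / 2 : ℝ) * ∫ s in θ..(θ + Real.pi), p s) (-p θ) θ := by
  have hF : ∀ t, HasDerivAt (fun x => ∫ s in (0 : ℝ)..x, p s) (p t) t := fun t =>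
    intervalIntegral.integral_hasDerivAt_right (hp.intervalIntegrable _ _)
      (hp.stronglyMeasurableAtFilter _ _) hp.continuousAt
  have heq : (fun θ => (1 / 2 : ℝ) * ∫ s in θ..(θ + Real.pi), p s) =
      fun θ => (1 / 2 : ℝ) * ((∫ s in (0 : ℝ)..(θ + Real.pi), p s) - ∫ s in (0 : ℝ)..θ, p s) := by
    funext t
    rw [intervalIntegral.integral_interval_sub_left (hp.intervalIntegrable _ _)
      (hp.intervalIntegrable _ _)]
  rw [heq]
  have := (((hF (θ + Real.pi)).comp_add_const θ Real.pi).sub (hF θ)).const_mul (1 / 2 : ℝ)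
  refine this.congr_deriv ?_
  rw [ha θ]; ring

theorem antiperiodic_half_integral {p : ℝ → ℝ} (ha : Function.Antiperiodic p Real.pi) :
    Function.Antiperiodic (fun θ => (1 / 2 : ℝ) * ∫ s in θ..(θ + Real.pi), p s) Real.pi :=
  fun θ => by
    have h := intervalIntegral.integral_comp_add_right (a := θ) (b := θ + Real.pi) p Real.pi
    simp only [ha _, intervalIntegral.integral_neg] at h
    simp only [← h, mul_neg]

theorem contDiff_of_hasDerivAt {E : Type*} [NormedAddCommGroup E] [NormedSpace ℝ E]
    {f f' : ℝ → E} (h : ∀ t, HasDerivAt f (f' t) t) (hf' : ContDiff ℝ ∞ f') : ContDiff ℝ ∞ f := by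
  rw [contDiff_infty_iff_deriv]
  refine ⟨fun t => (h t).differentiableAt, ?_⟩
  rwa [show deriv f = f' from funext fun t => (h t).deriv]

/-! ### Dual pairs and involutes -/

/-- The unit curve `w` and its dual `z`, where `w' = μ z` and `z' = -ν w`. -/
structure IsDualPair (w z : ℝ → Plane) (μ ν : ℝ → ℝ) : Prop where
  smooth : ContDiff ℝ ∞ w
  smooth_dual : ContDiff ℝ ∞ z
  antiperiodic : Function.Antiperiodic w Real.pi
  antiperiodic_dual : Function.Antiperiodic z Real.pi
  deriv_eq : ∀ θ, deriv w θ = μ θ • z θ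
  deriv_dual_eq : ∀ θ, deriv z θ = -(ν θ • w θ)
  bracket_eq : ∀ θ, bracket (w θ) (z θ) = 1
  pos : ∀ θ, 0 < μ θ
  pos_dual : ∀ θ, 0 < ν θ
  crosses : ∀ c ≠ 0, CrossesOnce (fun θ => bracket c (w θ)) (fun θ => bracket c (deriv w θ))
  crosses_dual : ∀ c ≠ 0, CrossesOnce (fun θ => bracket c (z θ)) (fun θ => bracket c (deriv z θ))

namespace IsDualPair

variable {w z : ℝ → Plane} {μ ν : ℝ → ℝ}

theorem bracket_dual_eq (h : IsDualPair w z μ ν) (θ : ℝ) : bracket (z θ) (w θ) = -1 := by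
  rw [bracket_swap, h.bracket_eq]

theorem bracket_deriv (h : IsDualPair w z μ ν) (θ : ℝ) : bracket (w θ) (deriv w θ) = μ θ := by
  simp [h.deriv_eq, h.bracket_eq]

theorem bracket_deriv_dual (h : IsDualPair w z μ ν) (θ : ℝ) :
    bracket (z θ) (deriv z θ) = ν θ := by
  simp [h.deriv_dual_eq, h.bracket_dual_eq]

/-- The dual of `v` is `-u`, so both kinds of involute are instances of one construction. -/
theorem swap (h : IsDualPair w z μ ν) : IsDualPair z (fun θ => -w θ) ν μ where
  smooth := h.smooth_dual
  smooth_dual := h.smooth.neg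
  antiperiodic := h.antiperiodic_dual
  antiperiodic_dual := fun θ => by simp [h.antiperiodic θ]
  deriv_eq := fun θ => by simp [h.deriv_dual_eq]
  deriv_dual_eq := fun θ => by
    rw [show (fun θ => -w θ) = -w from rfl, deriv.neg, h.deriv_eq]
  bracket_eq := fun θ => by simp [h.bracket_dual_eq]
  pos := h.pos_dual
  pos_dual := h.pos
  crosses := h.crosses_dual
  crosses_dual := fun c hc => by
    have := (h.crosses c hc).neg (fun θ => by simp [h.antiperiodic θ])
    refine this (fun θ => by simp [h.antiperiodic.deriv θ]) |>.imp fun θ hθ => ?_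
    simpa [show (fun θ => -w θ) = -w from rfl, deriv.neg] using hθ

theorem smooth_weight (h : IsDualPair w z μ ν) : ContDiff ℝ ∞ μ := by
  rw [← show (fun θ => bracket (w θ) (deriv w θ)) = μ from funext h.bracket_deriv]
  exact h.smooth.bracket h.smooth.deriv_infty

theorem periodic_weight (h : IsDualPair w z μ ν) : Function.Periodic μ Real.pi := fun θ => by
  rw [← h.bracket_deriv, ← h.bracket_deriv, h.antiperiodic θ, h.antiperiodic.deriv θ]
  simp

theorem dualCurve_eq (h : IsDualPair w z μ ν) : dualCurve w = z := by
  funext θ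
  rw [dualCurve, h.bracket_deriv, h.deriv_eq, smul_smul, inv_mul_cancel₀ (h.pos θ).ne', one_smul]

theorem isFront (h : IsDualPair w z μ ν) {X : ℝ → Plane} (hX : ContDiff ℝ ∞ X)
    (hper : Function.Periodic X Real.pi) (htan : ∀ θ, bracket (deriv X θ) (z θ) = 0) :
    IsFront z X where
  smooth := hX
  smooth_dir := h.smooth_dual
  periodic := hper
  antiperiodic_dir := h.antiperiodic_dual
  tangent := htan
  pos := fun θ => by rw [h.bracket_deriv_dual]; exact h.pos_dual θ
  crosses := h.crosses_dual

variable {X : ℝ → Plane}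

theorem curvatureRadius_mul (h : IsDualPair w z μ ν) (θ : ℝ) :
    μ θ * curvatureRadius w X θ = bracket (w θ) (deriv X θ) := by
  rw [curvatureRadius, h.bracket_deriv, mul_div_cancel₀ _ (h.pos θ).ne']

theorem deriv_eq_curvatureRadius_smul (h : IsDualPair w z μ ν) (hX : IsFront z X) (θ : ℝ) :
    deriv X θ = curvatureRadius w X θ • deriv w θ := by
  have h1 := exists_eq_smul_of_bracket_eq_zero (a := w θ) (by simp [h.bracket_eq]) (hX.tangent θ)
  rw [h.bracket_eq, div_one, ← h.curvatureRadius_mul] at h1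
  rw [h1, h.deriv_eq, smul_smul, mul_comm]

theorem contDiff_curvatureRadius (h : IsDualPair w z μ ν) (hX : IsFront z X) :
    ContDiff ℝ ∞ (curvatureRadius w X) :=
  (h.smooth.bracket hX.smooth.deriv_infty).div (h.smooth.bracket h.smooth.deriv_infty)
    fun θ => by rw [h.bracket_deriv]; exact (h.pos θ).ne'

theorem antiperiodic_curvatureRadius (h : IsDualPair w z μ ν) (hX : IsFront z X) :
    Function.Antiperiodic (curvatureRadius w X) Real.pi := fun θ => by
  simp only [curvatureRadius, h.antiperiodic θ, h.antiperiodic.deriv θ,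
    hX.periodic.deriv_of_periodic θ]
  simp [neg_div]

theorem involuteRadius_eq (h : IsDualPair w z μ ν) :
    involuteRadius w X = fun θ => (1 / 2 : ℝ) * ∫ s in θ..(θ + Real.pi),
      μ s * curvatureRadius w X s := by
  funext θ
  simp only [involuteRadius, h.bracket_deriv, mul_comm]

theorem hasDerivAt_involuteRadius (h : IsDualPair w z μ ν) (hX : IsFront z X) (θ : ℝ) :
    HasDerivAt (involuteRadius w X) (-(μ θ * curvatureRadius w X θ)) θ := by
  rw [h.involuteRadius_eq]
  exact hasDerivAt_half_integral
    (h.smooth_weight.continuous.mul (h.contDiff_curvatureRadius hX).continuous)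
    (fun θ => by simp [h.periodic_weight θ, h.antiperiodic_curvatureRadius hX θ]) θ

theorem antiperiodic_involuteRadius (h : IsDualPair w z μ ν) (hX : IsFront z X) :
    Function.Antiperiodic (involuteRadius w X) Real.pi := by
  rw [h.involuteRadius_eq]
  exact antiperiodic_half_integral
    fun θ => by simp [h.periodic_weight θ, h.antiperiodic_curvatureRadius hX θ]

theorem contDiff_involuteRadius (h : IsDualPair w z μ ν) (hX : IsFront z X) :
    ContDiff ℝ ∞ (involuteRadius w X) :=
  contDiff_of_hasDerivAt (h.hasDerivAt_involuteRadius hX)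
    (h.smooth_weight.mul (h.contDiff_curvatureRadius hX)).neg

theorem involute_eq (h : IsDualPair w z μ ν) (θ : ℝ) :
    involute w X θ = X θ + involuteRadius w X θ • z θ := by
  rw [involute, h.dualCurve_eq]

/-- The radius has derivative `-μ α`, which cancels `X' = α w' = α μ z`. -/
theorem deriv_involute (h : IsDualPair w z μ ν) (hX : IsFront z X) (θ : ℝ) :
    deriv (involute w X) θ = involuteRadius w X θ • deriv z θ := by
  have h1 : HasDerivAt (involute w X) (deriv X θ + (involuteRadius w X θ • deriv z θ +
      (-(μ θ * curvatureRadius w X θ)) • z θ)) θ := by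
    rw [show involute w X = fun θ => X θ + involuteRadius w X θ • z θ from funext h.involute_eq]
    exact (hX.smooth.hasDerivAt_deriv θ).add
      ((h.hasDerivAt_involuteRadius hX θ).smul (h.smooth_dual.hasDerivAt_deriv θ))
  rw [h1.deriv, h.deriv_eq_curvatureRadius_smul hX, h.deriv_eq]
  module

theorem curvatureRadius_involute (h : IsDualPair w z μ ν) (hX : IsFront z X) :
    curvatureRadius z (involute w X) = involuteRadius w X := funext fun θ =>
  curvatureRadius_eq (by rw [h.bracket_deriv_dual]; exact (h.pos_dual θ).ne')
    (h.deriv_involute hX θ)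

theorem isFront_involute (h : IsDualPair w z μ ν) (hX : IsFront z X) :
    IsFront (fun θ => -w θ) (involute w X) := by
  refine h.swap.isFront ?_ (fun θ => ?_) fun θ => ?_
  · rw [show involute w X = fun θ => X θ + involuteRadius w X θ • z θ from funext h.involute_eq]
    exact hX.smooth.add ((h.contDiff_involuteRadius hX).smul h.smooth_dual)
  · simp [h.involute_eq, hX.periodic θ, h.antiperiodic_involuteRadius hX θ, h.antiperiodic_dual θ]
  · simp [h.deriv_involute hX, h.deriv_dual_eq]

/-- The points that lie on a single tangent of `X` lie on a single tangent of its involute. -/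
theorem crossSet_subset_crossSet_involute (h : IsDualPair w z μ ν) (hX : IsFront z X) :
    crossSet z X ⊆ crossSet (fun θ => -w θ) (involute w X) := by
  rintro x ⟨t, -, -, ht⟩
  have hY := h.isFront_involute hX
  have h1 := hY.antiperiodic x 1
  have h2 := hY.hasDerivAt x 1
  simp only [one_smul] at h1 h2
  refine CrossesOnce.of_deriv_neg h1 h2 (ψ := t) fun θ hθ => ?_
  rw [show (fun θ => -w θ) = -w from rfl, deriv.neg, h.deriv_eq, h.involute_eq, sub_add_eq_sub_sub]
  have := mul_pos (h.pos θ) (ht θ hθ)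
  simp only [bracket_neg_right, bracket_smul_right, bracket_sub_left, bracket_smul_left,
    bracket_self] at this ⊢
  linarith

end IsDualPair

/-- Two involutes turn the direction `z` into `-z`; this restores the original one. -/
theorem IsFront.neg_dir {z X : ℝ → Plane} (h : IsFront (fun θ => -z θ) X) : IsFront z X where
  smooth := h.smooth
  smooth_dir := by simpa using h.smooth_dir.neg
  periodic := h.periodic
  antiperiodic_dir := fun θ => by simpa using congrArg Neg.neg (h.antiperiodic_dir θ)
  tangent := fun θ => by simpa using h.tangent θ
  pos := fun θ => by
    simpa [show (fun θ => -z θ) = -z from rfl, deriv.neg] using h.pos θ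
  crosses := fun c hc => by
    simpa [show (fun θ => -z θ) = -z from rfl, deriv.neg] using h.crosses (-c) (by simpa using hc)

theorem crossSet_neg_dir {z X : ℝ → Plane} (h : IsFront (fun θ => -z θ) X) :
    crossSet (fun θ => -z θ) X ⊆ crossSet z X := by
  intro x hx
  have := CrossesOnce.neg ?_ ?_ hx
  · simpa [crossSet, show (fun θ => -z θ) = -z from rfl, deriv.neg] using this
  · simpa only [one_smul] using h.antiperiodic x 1
  · simpa only [one_smul] using h.antiperiodic' x 1

/-! ### Tangent directions and convex curves -/

theorem bracket_eTheta_eTheta (s t : ℝ) : bracket (eTheta s) (eTheta t) = Real.sin (t - s) := by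
  simp [bracket, eTheta, Real.sin_sub]; ring

theorem hasDerivAt_vec {a b : ℝ → ℝ} {a' b' t : ℝ} (ha : HasDerivAt a a' t)
    (hb : HasDerivAt b b' t) : HasDerivAt (fun s => (!₂[a s, b s] : Plane)) !₂[a', b'] t := by
  have h : ∀ x y : ℝ, (!₂[x, y] : Plane) = x • !₂[1, 0] + y • !₂[0, 1] := fun x y => by
    ext i; fin_cases i <;> simp
  rw [h a' b', show (fun s => (!₂[a s, b s] : Plane)) = _ from funext fun s => h (a s) (b s)]
  exact (ha.smul_const _).add (hb.smul_const _)

theorem hasDerivAt_eTheta (t : ℝ) :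
    HasDerivAt eTheta (!₂[-Real.cos t, -Real.sin t] : Plane) t := by
  exact hasDerivAt_vec (Real.hasDerivAt_sin t).neg (Real.hasDerivAt_cos t)

theorem contDiff_eTheta : ContDiff ℝ ∞ eTheta := by
  rw [contDiff_euclidean]
  intro i
  fin_cases i
  · simpa [eTheta] using Real.contDiff_sin.neg
  · simpa [eTheta] using Real.contDiff_cos

theorem antiperiodic_eTheta : Function.Antiperiodic eTheta Real.pi := fun t => by
  ext i; fin_cases i <;> simp [eTheta]

namespace IsConvexCurve

variable {γ : ℝ → Plane}

theorem hasDerivAt (hγ : IsConvexCurve γ) : ∃ r : ℝ → ℝ, (∀ θ, 0 < r θ) ∧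
    ∀ θ, HasDerivAt γ (r θ • eTheta θ) θ := by
  choose r hr hr' using hγ.tangent
  exact ⟨r, hr, fun θ => hr' θ ▸ hγ.smooth.hasDerivAt_deriv θ⟩

/-- On an arc on which the bracket of `w` with the tangent direction is positive, the function
`[γ, w]` increases. -/
theorem bracket_lt_bracket (hγ : IsConvexCurve γ) {w : Plane} {a b : ℝ} (hab : a < b)
    (h : ∀ t ∈ Ioo a b, 0 < bracket (eTheta t) w) : bracket (γ a) w < bracket (γ b) w := by
  obtain ⟨r, hr, hd⟩ := hγ.hasDerivAt
  have hd' : ∀ t, HasDerivAt (fun t => bracket (γ t) w) (r t * bracket (eTheta t) w) t :=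
      fun t => by
    refine ((hd t).bracket (hasDerivAt_const t w)).congr_deriv ?_
    simp [bracket_swap _ (0 : Plane)]
  have : StrictMonoOn (fun t => bracket (γ t) w) (Icc a b) :=
    strictMonoOn_of_deriv_pos (convex_Icc _ _)
      (continuous_iff_continuousAt.2 fun t => (hd' t).continuousAt).continuousOn fun t ht => by
        rw [interior_Icc] at ht
        rw [(hd' t).deriv]
        exact mul_pos (hr t) (h t ht)
  exact this (left_mem_Icc.2 hab.le) (right_mem_Icc.2 hab.le) hab

theorem bracket_sub_eTheta_pos (hγ : IsConvexCurve γ) (θ : ℝ) :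
    0 < bracket (γ θ - γ (θ + Real.pi)) (eTheta θ) := by
  have := hγ.bracket_lt_bracket (w := -eTheta θ) (a := θ) (b := θ + Real.pi)
    (by linarith [Real.pi_pos]) fun t ht => by
      rw [bracket_neg_right, bracket_eTheta_eTheta, ← Real.sin_neg]
      exact Real.sin_pos_of_pos_of_lt_pi (by linarith [ht.1]) (by linarith [ht.2])
  simp only [bracket_neg_right, bracket_sub_left] at this ⊢
  linarith

/-- The points `γ ψ`, `γ θ`, `γ (θ + π)` are positively oriented for `ψ < θ < ψ + π`. -/
theorem bracket_sub_sub_pos (hγ : IsConvexCurve γ) {ψ θ : ℝ} (hθ : θ ∈ Ioo ψ (ψ + Real.pi)) :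
    0 < bracket (γ θ - γ ψ) (γ (θ + Real.pi) - γ ψ) := by
  have hpi := Real.pi_pos
  rw [bracket_sub_left, sub_pos]
  refine hγ.bracket_lt_bracket hθ.1 fun s hs => ?_
  -- The arc from `θ + π` to `ψ + 2π` returns to `γ ψ`, so it controls the chord `γ (θ + π) - γ ψ`.
  have := hγ.bracket_lt_bracket (w := eTheta s) (a := θ + Real.pi) (b := ψ + 2 * Real.pi)
    (by linarith [hθ.2]) fun t ht => by
      rw [bracket_eTheta_eTheta, show s - t = Real.pi - (t - s - Real.pi) - 2 * Real.pi by ring,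
        Real.sin_sub_two_pi, Real.sin_pi_sub]
      exact Real.sin_pos_of_pos_of_lt_pi (by linarith [ht.1, hs.2]) (by linarith [ht.2, hs.1])
  rw [hγ.periodic ψ] at this
  rw [bracket_swap, bracket_sub_left]
  linarith

end IsConvexCurve

/-! ### The unit curve and its support function -/

section UnitCurve

variable {u : ℝ → Plane} {ρ : ℝ → ℝ}

/-- The support function of the unit curve `u`. -/
noncomputable def supportFun (u : ℝ → Plane) (θ : ℝ) : ℝ := bracket (u θ) (eTheta θ)

theorem contDiff_supportFun (hu : ContDiff ℝ ∞ u) : ContDiff ℝ ∞ (supportFun u) :=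
  hu.bracket contDiff_eTheta

theorem periodic_supportFun (hu : Function.Antiperiodic u Real.pi) :
    Function.Periodic (supportFun u) Real.pi := fun θ => by
  simp [supportFun, hu θ, antiperiodic_eTheta θ]

theorem hasDerivAt_supportFun (hu : ∀ θ, HasDerivAt u (ρ θ • eTheta θ) θ) (θ : ℝ) :
    HasDerivAt (supportFun u) (bracket (u θ) !₂[-Real.cos θ, -Real.sin θ]) θ := by
  refine ((hu θ).bracket (hasDerivAt_eTheta θ)).congr_deriv ?_
  simp

/-- This is the classical formula `h + h'' = ρ` for the radius of curvature. -/
theorem hasDerivAt_deriv_supportFun (hu : ∀ θ, HasDerivAt u (ρ θ • eTheta θ) θ) (θ : ℝ) :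
    HasDerivAt (deriv (supportFun u)) (ρ θ - supportFun u θ) θ := by
  rw [show deriv (supportFun u) = fun θ => bracket (u θ) !₂[-Real.cos θ, -Real.sin θ] from
    funext fun t => (hasDerivAt_supportFun hu t).deriv]
  have h1 : HasDerivAt (fun θ => (!₂[-Real.cos θ, -Real.sin θ] : Plane)) (-eTheta θ) θ := by
    refine (hasDerivAt_vec (Real.hasDerivAt_cos θ).neg (Real.hasDerivAt_sin θ).neg).congr_deriv ?_
    ext i; fin_cases i <;> simp [eTheta]
  refine ((hu θ).bracket h1).congr_deriv ?_
  have h2 : bracket (eTheta θ) !₂[-Real.cos θ, -Real.sin θ] = 1 := by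
    simp [bracket, eTheta, ← sq]
  simp [h2, supportFun, sub_eq_add_neg]

/-- In polar form `[c, v]` is `g |c| cos (θ - arg c)`, and `g > 0` does not affect signs. -/
theorem crossesOnce_smul_eTheta {v v' : ℝ → Plane} {g : ℝ → ℝ} (hg : ∀ θ, 0 < g θ)
    (hgd : Differentiable ℝ g) (hv : v = fun θ => g θ • eTheta θ)
    (hv' : ∀ θ, HasDerivAt v (v' θ) θ) {c : Plane} (hc : c ≠ 0) :
    CrossesOnce (fun θ => bracket c (v θ)) (fun θ => bracket c (v' θ)) := by
  have hpi := Real.pi_pos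
  set ζ : ℂ := ⟨c 0, c 1⟩ with hζ
  have hζ0 : ζ ≠ 0 := fun h => hc <| by
    ext i
    fin_cases i
    · simpa [hζ] using congrArg Complex.re h
    · simpa [hζ] using congrArg Complex.im h
  have hn : 0 < ‖ζ‖ := norm_pos_iff.2 hζ0
  have h0 : c 0 = ‖ζ‖ * Real.cos ζ.arg := by rw [Complex.norm_mul_cos_arg]
  have h1 : c 1 = ‖ζ‖ * Real.sin ζ.arg := by rw [Complex.norm_mul_sin_arg]
  have e1 : ∀ θ, bracket c (v θ) = g θ * (‖ζ‖ * Real.cos (θ - ζ.arg)) := fun θ => by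
    rw [hv, Real.cos_sub]
    simp only [bracket, eTheta, h0, h1, PiLp.smul_apply, smul_eq_mul]
    simp [-Complex.norm_mul_cos_arg, -Complex.norm_mul_sin_arg]
    ring
  have e2 : ∀ θ, HasDerivAt (fun θ => bracket c (v θ)) (bracket c (v' θ)) θ := fun θ => by
    refine ((hasDerivAt_const θ c).bracket (hv' θ)).congr_deriv ?_
    simp
  refine ⟨ζ.arg - Real.pi / 2, ?_, ?_, fun θ hθ => ?_⟩
  · simp only [e1]
    rw [show ζ.arg - Real.pi / 2 - ζ.arg = -(Real.pi / 2) by ring]; simp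
  · set t := ζ.arg - Real.pi / 2 with ht
    have e3 : HasDerivAt (fun θ => g θ * (‖ζ‖ * Real.cos (θ - ζ.arg)))
        (deriv g t * (‖ζ‖ * Real.cos (t - ζ.arg)) + g t * (‖ζ‖ * -Real.sin (t - ζ.arg))) t :=
      (hgd t).hasDerivAt.mul
        (((Real.hasDerivAt_cos (t - ζ.arg)).comp_sub_const t ζ.arg).const_mul ‖ζ‖)
    have e4 := (e2 t).unique (by simpa only [e1] using e3)
    rw [show t - ζ.arg = -(Real.pi / 2) by rw [ht]; ring] at e4
    simp only [e4]
    have := hg t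
    simp
    positivity
  · simp only [e1]
    have : 0 < Real.cos (θ - ζ.arg) :=
      Real.cos_pos_of_mem_Ioo ⟨by linarith [hθ.1], by linarith [hθ.2]⟩
    have := hg θ
    positivity

/-- With `e = eTheta`, `v = e / h`; since `u = h' e - h e'`, this gives `v' = -u / h²`. -/
theorem isDualPair_dualCurve (hu : ContDiff ℝ ∞ u) (hua : Function.Antiperiodic u Real.pi)
    (hρ : ∀ θ, 0 < ρ θ) (hud : ∀ θ, HasDerivAt u (ρ θ • eTheta θ) θ)
    (hpos : ∀ θ, 0 < supportFun u θ) :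
    (dualCurve u = fun θ => (supportFun u θ)⁻¹ • eTheta θ) ∧
    IsDualPair u (dualCurve u) (fun θ => ρ θ * supportFun u θ)
      (fun θ => (supportFun u θ ^ 2)⁻¹) := by
  have hne : ∀ θ, supportFun u θ ≠ 0 := fun θ => (hpos θ).ne'
  have hsm := contDiff_supportFun hu
  have hv : dualCurve u = fun θ => (supportFun u θ)⁻¹ • eTheta θ := by
    funext θ
    rw [dualCurve, (hud θ).deriv, bracket_smul_right, smul_smul]
    congr 1
    have := (hρ θ).ne'
    have := hne θ
    unfold supportFun at this ⊢
    field_simp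
  have hvd : ∀ θ, HasDerivAt (dualCurve u) (-((supportFun u θ ^ 2)⁻¹ • u θ)) θ := fun θ => by
    rw [hv]
    have h1 := ((hasDerivAt_supportFun hud θ).inv (hne θ)).smul (hasDerivAt_eTheta θ)
    refine h1.congr_deriv ?_
    have h2 : ((supportFun u θ)⁻¹ : ℝ) = (supportFun u θ ^ 2)⁻¹ * supportFun u θ := by
      have := hne θ
      field_simp
    rw [Pi.inv_apply, h2, neg_div, div_eq_inv_mul, mul_smul, ← mul_neg, mul_smul,
      ← smul_add, ← smul_neg]
    congr 1
    have h3 := Real.sin_sq_add_cos_sq θ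
    ext i
    fin_cases i
    · simp [supportFun, bracket, eTheta]
      linear_combination -(u θ 0) * h3
    · simp [supportFun, bracket, eTheta]
      linear_combination -(u θ 1) * h3
  have hcr := fun (c : Plane) (hc : c ≠ 0) => crossesOnce_smul_eTheta
    (g := fun θ => (supportFun u θ)⁻¹) (fun θ => inv_pos.2 (hpos θ))
    ((hsm.inv hne).differentiable (by simp)) hv hvd hc
  have hva : Function.Antiperiodic (dualCurve u) Real.pi := fun θ => by
    simp [hv, periodic_supportFun hua θ, antiperiodic_eTheta θ]
  have hdu : ∀ θ, deriv u θ = (ρ θ * supportFun u θ) • dualCurve u θ := fun θ => by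
    rw [(hud θ).deriv, hv, smul_smul, mul_assoc, mul_inv_cancel₀ (hne θ), mul_one]
  refine ⟨hv, hu, ?_, hua, hva, hdu, fun θ => (hvd θ).deriv, fun θ => ?_, fun θ =>
    mul_pos (hρ θ) (hpos θ), fun θ => by have := hpos θ; positivity, fun c hc => ?_,
    fun c hc => ?_⟩
  · rw [hv]; exact (hsm.inv hne).smul contDiff_eTheta
  · rw [hv]; simp only [bracket_smul_right]; exact inv_mul_cancel₀ (hne θ)
  -- As `[c, u]' = μ [c, v]`, the crossing of `[c, v]` makes `[c, u]` monotone; the shift by `π`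
  -- selects the half period where it decreases.
  · obtain ⟨t, -, -, ht⟩ := hcr c hc
    refine CrossesOnce.of_deriv_neg (fun θ => by simp [hua θ]) (fun θ => ?_)
      (ψ := t + Real.pi) fun θ hθ => ?_
    · refine ((hasDerivAt_const θ c).bracket (hu.hasDerivAt_deriv θ)).congr_deriv ?_
      simp
    · obtain ⟨s, rfl⟩ : ∃ s, θ = s + Real.pi := ⟨θ - Real.pi, by ring⟩
      have h1 := ht s ⟨by linarith [hθ.1], by linarith [hθ.2]⟩
      rw [hua.deriv s, hdu]
      simp only [bracket_neg_right, bracket_smul_right]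
      have := mul_pos (mul_pos (hρ s) (hpos s)) h1
      linarith
  · simpa only [(hvd _).deriv] using hcr c hc

end UnitCurve

/-! ### The dual pair and the front attached to a convex curve -/

theorem symmetrization_antiperiodic {γ : ℝ → Plane} (hγ : Function.Periodic γ (2 * Real.pi)) :
    Function.Antiperiodic (symmetrization γ) Real.pi := fun θ => by
  rw [symmetrization, symmetrization, add_assoc, ← two_mul, hγ θ]; module

theorem areaEvolute_periodic {γ : ℝ → Plane} (hγ : Function.Periodic γ (2 * Real.pi)) :
    Function.Periodic (areaEvolute γ) Real.pi := fun θ => by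
  rw [areaEvolute, areaEvolute, add_assoc, ← two_mul, hγ θ]; module

/-- The data attached to a convex curve `γ` and its Minkowski unit curve `u`. -/
theorem IsConvexCurve.exists_dualPair {γ u : ℝ → Plane} (hγ : IsConvexCurve γ)
    (hu : ∃ k : ℝ, 0 < k ∧ ∀ θ, u θ = k • symmetrization γ θ) :
    ∃ ρ : ℝ → ℝ, (∀ θ, HasDerivAt u (ρ θ • eTheta θ) θ) ∧ (∀ θ, 0 < supportFun u θ) ∧
      (dualCurve u = fun θ => (supportFun u θ)⁻¹ • eTheta θ) ∧
      IsDualPair u (dualCurve u) (fun θ => ρ θ * supportFun u θ)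
        (fun θ => (supportFun u θ ^ 2)⁻¹) ∧
      IsFront (dualCurve u) (areaEvolute γ) ∧
      range γ ⊆ crossSet (dualCurve u) (areaEvolute γ) := by
  obtain ⟨k, hk, hu⟩ := hu
  obtain ⟨r, hr, hd⟩ := hγ.hasDerivAt
  have hdπ : ∀ θ, HasDerivAt (fun θ => γ (θ + Real.pi)) (-(r (θ + Real.pi) • eTheta θ)) θ :=
    fun θ => by
      have := (hd (θ + Real.pi)).comp_add_const θ Real.pi
      rwa [antiperiodic_eTheta θ, smul_neg] at this
  have hsmπ : ContDiff ℝ ∞ (fun θ => γ (θ + Real.pi)) :=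
    hγ.smooth.comp (contDiff_id.add contDiff_const)
  have hueq : u = fun θ => k • symmetrization γ θ := funext hu
  have husm : ContDiff ℝ ∞ u := by
    rw [hueq]
    exact ((hγ.smooth.sub hsmπ).const_smul (1 / 2 : ℝ)).const_smul k
  have hua : Function.Antiperiodic u Real.pi := fun θ => by
    simp [hu, symmetrization_antiperiodic hγ.periodic θ]
  have hud : ∀ θ, HasDerivAt u ((k * (1 / 2) * (r θ + r (θ + Real.pi))) • eTheta θ) θ := fun θ => by
    rw [hueq]
    refine ((((hd θ).sub (hdπ θ)).const_smul (1 / 2 : ℝ)).const_smul k).congr_deriv ?_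
    module
  have hpos : ∀ θ, 0 < supportFun u θ := fun θ => by
    have := hγ.bracket_sub_eTheta_pos θ
    rw [supportFun, hu, symmetrization, bracket_smul_left, bracket_smul_left]
    positivity
  obtain ⟨hv, hpair⟩ := isDualPair_dualCurve husm hua
    (fun θ => by have := hr θ; have := hr (θ + Real.pi); positivity) hud hpos
  have hMsm : ContDiff ℝ ∞ (areaEvolute γ) := (hγ.smooth.add hsmπ).const_smul (1 / 2 : ℝ)
  have hfront : IsFront (dualCurve u) (areaEvolute γ) := by
    refine hpair.isFront hMsm (areaEvolute_periodic hγ.periodic) fun θ => ?_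
    have h1 : HasDerivAt (areaEvolute γ) _ θ := ((hd θ).add (hdπ θ)).const_smul (1 / 2 : ℝ)
    rw [h1.deriv, hv]
    simp
  refine ⟨_, hud, hpos, hv, hpair, hfront, ?_⟩
  rintro _ ⟨ψ, rfl⟩
  have h1 := hfront.antiperiodic (γ ψ) 1
  have h2 := hfront.hasDerivAt (γ ψ) 1
  simp only [one_smul] at h1 h2
  refine CrossesOnce.of_deriv_neg h1 h2 (ψ := ψ) fun θ hθ => ?_
  have h3 := hγ.bracket_sub_sub_pos hθ
  -- The area evolute is the midpoint of the diameter and `u` points along it, so the bracket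
  -- measures the triangle `γ ψ`, `γ θ`, `γ (θ + π)`.
  have h4 : bracket (γ ψ - areaEvolute γ θ) (u θ) =
      k / 2 * bracket (γ θ - γ ψ) (γ (θ + Real.pi) - γ ψ) := by
    rw [hu, symmetrization, areaEvolute]
    simp [bracket]; ring
  rw [hpair.deriv_dual_eq, bracket_neg_right, bracket_smul_right, h4]
  have := hpos θ
  have : 0 < (supportFun u θ ^ 2)⁻¹ *
    (k / 2 * bracket (γ θ - γ ψ) (γ (θ + Real.pi) - γ ψ)) := by positivity
  linarith

/-! ### Wirtinger's inequality -/

theorem fourierCoeffOn_two_pi_of_abs_one {r : ℝ → ℝ} (hr : Continuous r)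
    (hcos : ∫ x in (0 : ℝ)..(2 * Real.pi), r x * Real.cos x = 0)
    (hsin : ∫ x in (0 : ℝ)..(2 * Real.pi), r x * Real.sin x = 0) {n : ℤ} (hn : n = 1 ∨ n = -1) :
    fourierCoeffOn Real.two_pi_pos (fun x => (r x : ℂ)) n = 0 := by
  rw [fourierCoeffOn_eq_integral]
  have hπ : (Real.pi : ℂ) ≠ 0 := by exact_mod_cast Real.pi_ne_zero
  have key : ∀ x : ℝ, fourier (-n) (x : AddCircle (2 * Real.pi - 0)) • (r x : ℂ) =
      ((r x * Real.cos x : ℝ) : ℂ) - n * Complex.I * ((r x * Real.sin x : ℝ) : ℂ) := fun x => by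
    rw [fourier_coe_apply]
    have : 2 * (Real.pi : ℂ) * Complex.I * ((-n : ℤ) : ℂ) * (x : ℂ) / ((2 * Real.pi - 0 : ℝ) : ℂ) =
        ((-n : ℤ) * x : ℂ) * Complex.I := by
      push_cast; field_simp; ring
    rw [this, Complex.exp_mul_I]
    rcases hn with rfl | rfl
    · simp; ring
    · simp; ring
  simp only [key]
  rw [intervalIntegral.integral_sub, intervalIntegral.integral_const_mul,
    intervalIntegral.integral_ofReal, intervalIntegral.integral_ofReal, hcos, hsin]
  · simp
  · exact (Complex.continuous_ofReal.comp (hr.mul Real.continuous_cos)).intervalIntegrable _ _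
  · exact (continuous_const.mul
      (Complex.continuous_ofReal.comp (hr.mul Real.continuous_sin))).intervalIntegrable _ _

/-- Wirtinger's inequality for functions without harmonics of order `0` and `1`. -/
theorem four_mul_integral_sq_le {r r' : ℝ → ℝ} (hd : ∀ x, HasDerivAt r (r' x) x)
    (hr' : Continuous r') (hper : Function.Periodic r (2 * Real.pi))
    (h0 : ∫ x in (0 : ℝ)..(2 * Real.pi), r x = 0)
    (hcos : ∫ x in (0 : ℝ)..(2 * Real.pi), r x * Real.cos x = 0)
    (hsin : ∫ x in (0 : ℝ)..(2 * Real.pi), r x * Real.sin x = 0) :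
    4 * ∫ x in (0 : ℝ)..(2 * Real.pi), r x ^ 2 ≤ ∫ x in (0 : ℝ)..(2 * Real.pi), r' x ^ 2 := by
  have hpi := Real.two_pi_pos
  have hr : Continuous r := continuous_iff_continuousAt.2 fun x => (hd x).continuousAt
  have hL2 : ∀ {f : ℝ → ℝ}, Continuous f → MeasureTheory.MemLp (fun x => (f x : ℂ)) 2
      (MeasureTheory.volume.restrict (Ioc 0 (2 * Real.pi))) := fun {f} hf => by
    have hc : Continuous fun x => (f x : ℂ) := Complex.continuous_ofReal.comp hf
    obtain ⟨C, hC⟩ := (isCompact_Icc (a := 0) (b := 2 * Real.pi)).exists_bound_of_continuousOn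
      hc.continuousOn
    refine MeasureTheory.MemLp.of_bound hc.aestronglyMeasurable C ?_
    rw [MeasureTheory.ae_restrict_iff' measurableSet_Ioc]
    exact Eventually.of_forall fun x hx => hC x (Ioc_subset_Icc_self hx)
  have hP := fun {f : ℝ → ℝ} (hf : Continuous f) => hasSum_sq_fourierCoeffOn hpi (hL2 hf)
  -- Parseval sums are compared termwise: differentiation multiplies the `n`-th coefficient by `|n|`
  -- in norm, and only `|n| ≥ 2` contributes to `r`.
  have hle := hasSum_le (fun n : ℤ => ?_) ((hP hr).mul_left 4) (hP hr')
  · simp only [Complex.norm_real, Real.norm_eq_abs, sq_abs, sub_zero, smul_eq_mul] at hle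
    rw [mul_left_comm] at hle
    exact le_of_mul_le_mul_left hle (by positivity)
  · rcases eq_or_ne n 0 with rfl | hn
    · have : fourierCoeffOn hpi (fun x => (r x : ℂ)) 0 = 0 := by
        rw [fourierCoeffOn_eq_integral]
        have h1 : ∫ x in (0 : ℝ)..(2 * Real.pi), (r x : ℂ) = 0 := by
          rw [intervalIntegral.integral_ofReal, h0]; simp
        simp [h1]
      rw [this]; simp
    by_cases h1 : n = 1 ∨ n = -1
    · rw [fourierCoeffOn_two_pi_of_abs_one hr hcos hsin h1]; simp
    have hc := fourierCoeffOn_of_hasDerivAt hpi (f := fun x => (r x : ℂ))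
      (f' := fun x => (r' x : ℂ)) hn (fun x _ => (hd x).ofReal_comp)
      ((Complex.continuous_ofReal.comp hr').intervalIntegrable _ _)
    have hp0 : r (2 * Real.pi) = r 0 := by simpa using hper 0
    rw [hp0, sub_self, mul_zero, zero_sub] at hc
    have hnorm := congrArg norm hc
    simp only [norm_mul, norm_div, norm_neg, norm_one, Complex.norm_I, Complex.norm_ofNat,
      Complex.norm_real, Complex.norm_intCast, Real.norm_of_nonneg Real.pi_pos.le,
      Complex.ofReal_zero, sub_zero, Complex.ofReal_mul, Complex.ofReal_ofNat] at hnorm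
    have hn2 : (2 : ℝ) ≤ |(n : ℝ)| := by
      have : (2 : ℤ) ≤ |n| := by
        rcases abs_cases n with h | h <;> omega
      exact_mod_cast this
    have hpi' := Real.pi_pos
    have e : ‖fourierCoeffOn hpi (fun x => (r' x : ℂ)) n‖ =
        |(n : ℝ)| * ‖fourierCoeffOn hpi (fun x => (r x : ℂ)) n‖ := by
      rw [hnorm]; field_simp
    rw [e, mul_pow]
    gcongr
    nlinarith

/-- The quantitative isoperimetric gap: the quadratic form `∫ q'² - q²` controls the distance of
`q` to the space of first harmonics. -/
theorem exists_three_mul_integral_sq_le {q q' : ℝ → ℝ} (hd : ∀ x, HasDerivAt q (q' x) x)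
    (hq' : Continuous q') (ha : Function.Antiperiodic q Real.pi) :
    ∃ c : Plane, 3 * ∫ x in (0 : ℝ)..(2 * Real.pi), (q x - bracket c (eTheta x)) ^ 2 ≤
      ∫ x in (0 : ℝ)..(2 * Real.pi), (q' x ^ 2 - q x ^ 2) := by
  have hpi := Real.pi_pos
  have hq : Continuous q := continuous_iff_continuousAt.2 fun x => (hd x).continuousAt
  set a := (1 / Real.pi) * ∫ x in (0 : ℝ)..(2 * Real.pi), q x * Real.cos x with hadef
  set b := (1 / Real.pi) * ∫ x in (0 : ℝ)..(2 * Real.pi), q x * Real.sin x with hbdef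
  set p : ℝ → ℝ := fun x => a * Real.cos x + b * Real.sin x with hp
  set p' : ℝ → ℝ := fun x => -a * Real.sin x + b * Real.cos x with hp'
  have hpc : Continuous p := by fun_prop
  have hpc' : Continuous p' := by fun_prop
  have hpd : ∀ x, HasDerivAt p (p' x) x := fun x => by
    refine (((Real.hasDerivAt_cos x).const_mul a).add
      ((Real.hasDerivAt_sin x).const_mul b)).congr_deriv ?_
    simp [hp']
  have hpd' : ∀ x, HasDerivAt p' (-p x) x := fun x => by
    refine (((Real.hasDerivAt_sin x).const_mul (-a)).add
      ((Real.hasDerivAt_cos x).const_mul b)).congr_deriv ?_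
    simp [hp]; ring
  have hpper : Function.Antiperiodic p Real.pi := fun x => by simp [hp]; ring
  have hpper' : Function.Antiperiodic p' Real.pi := fun x => by simp [hp']; ring
  have hrd : ∀ x, HasDerivAt (fun x => q x - p x) (q' x - p' x) x := fun x => (hd x).sub (hpd x)
  have hra : Function.Antiperiodic (fun x => q x - p x) Real.pi := fun x => by
    simp [ha x, hpper x]; ring
  have hrper := hra.periodic_two_mul
  have hint0 : ∀ {g g' : ℝ → ℝ}, (∀ x, HasDerivAt g (g' x) x) → Continuous g' →
      Function.Periodic g (2 * Real.pi) → ∫ x in (0 : ℝ)..(2 * Real.pi), g' x = 0 :=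
    fun {g g'} hg hg' hgp => by
      rw [intervalIntegral.integral_eq_sub_of_hasDerivAt (fun x _ => hg x)
        (hg'.intervalIntegrable _ _)]
      have := hgp 0
      rw [zero_add] at this; rw [this, sub_self]
  have hII : ∀ {g : ℝ → ℝ}, Continuous g → IntervalIntegrable g MeasureTheory.volume 0
      (2 * Real.pi) := fun hg => hg.intervalIntegrable _ _
  have h0 : ∫ x in (0 : ℝ)..(2 * Real.pi), (q x - p x) = 0 := by
    have h1 := intervalIntegral.integral_add_adjacent_intervals
      ((hq.sub hpc).intervalIntegrable (μ := MeasureTheory.volume) 0 Real.pi)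
      ((hq.sub hpc).intervalIntegrable Real.pi (2 * Real.pi))
    have h2 := intervalIntegral.integral_comp_add_right (a := 0) (b := Real.pi)
      (fun x => q x - p x) Real.pi
    simp only [hra _, intervalIntegral.integral_neg, zero_add, ← two_mul] at h2
    simp only [Pi.sub_apply] at h1
    rw [← h1, ← h2]; ring
  have hcs : ∫ x in (0 : ℝ)..(2 * Real.pi), Real.sin x * Real.cos x = 0 := by
    simp [integral_sin_mul_cos₁]
  have hcc : ∫ x in (0 : ℝ)..(2 * Real.pi), Real.cos x ^ 2 = Real.pi := by
    rw [integral_cos_sq]; simp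
  have hss : ∫ x in (0 : ℝ)..(2 * Real.pi), Real.sin x ^ 2 = Real.pi := by
    rw [integral_sin_sq]; simp
  have hcos : ∫ x in (0 : ℝ)..(2 * Real.pi), (q x - p x) * Real.cos x = 0 := by
    have : ∀ x, (q x - p x) * Real.cos x = q x * Real.cos x -
        (a * Real.cos x ^ 2 + b * (Real.sin x * Real.cos x)) := fun x => by simp only [hp]; ring
    simp only [this]
    rw [intervalIntegral.integral_sub (hII (by fun_prop)) (hII (by fun_prop)),
      intervalIntegral.integral_add (hII (by fun_prop)) (hII (by fun_prop)),
      intervalIntegral.integral_const_mul, intervalIntegral.integral_const_mul, hcs, hcc, hadef]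
    field_simp; ring
  have hsin : ∫ x in (0 : ℝ)..(2 * Real.pi), (q x - p x) * Real.sin x = 0 := by
    have : ∀ x, (q x - p x) * Real.sin x = q x * Real.sin x -
        (a * (Real.sin x * Real.cos x) + b * Real.sin x ^ 2) := fun x => by simp only [hp]; ring
    simp only [this]
    rw [intervalIntegral.integral_sub (hII (by fun_prop)) (hII (by fun_prop)),
      intervalIntegral.integral_add (hII (by fun_prop)) (hII (by fun_prop)),
      intervalIntegral.integral_const_mul, intervalIntegral.integral_const_mul, hcs, hss, hbdef]
    field_simp; ring
  have hW := four_mul_integral_sq_le hrd (hq'.sub hpc') hrper h0 hcos hsin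
  -- First harmonics lie in the kernel of the form `∫ (q'² - q²)`, so subtracting `p` does not
  -- change it; the constant is then `4 - 1 = 3`.
  have hz : ∫ x in (0 : ℝ)..(2 * Real.pi), ((q' x * p' x - q x * p x) * 2 -
      (p' x * p' x - p x * p x)) = 0 := by
    refine hint0 (g := fun x => (q x * p' x) * 2 - p x * p' x) (fun x => ?_) (by fun_prop) ?_
    · refine ((((hd x).mul (hpd' x)).mul_const 2).sub ((hpd x).mul (hpd' x))).congr_deriv ?_
      ring
    · intro x
      simp only [ha.periodic_two_mul x, hpper.periodic_two_mul x, hpper'.periodic_two_mul x]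
  refine ⟨!₂[a, b], ?_⟩
  have hbr : ∀ x, bracket (!₂[a, b] : Plane) (eTheta x) = p x := fun x => by
    simp [bracket, eTheta, hp]
  simp only [hbr]
  have hsplit : ∫ x in (0 : ℝ)..(2 * Real.pi), (q' x ^ 2 - q x ^ 2) =
      (∫ x in (0 : ℝ)..(2 * Real.pi), (q' x - p' x) ^ 2) -
        ∫ x in (0 : ℝ)..(2 * Real.pi), (q x - p x) ^ 2 := by
    have e : ∀ x, q' x ^ 2 - q x ^ 2 = ((q' x - p' x) ^ 2 - (q x - p x) ^ 2) +
        ((q' x * p' x - q x * p x) * 2 - (p' x * p' x - p x * p x)) := fun x => by ring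
    simp only [e]
    rw [intervalIntegral.integral_add (hII (by fun_prop)) (hII (by fun_prop)), hz, add_zero,
      intervalIntegral.integral_sub (hII (by fun_prop)) (hII (by fun_prop))]
  rw [hsplit]
  linarith

/-! ### The spectral gap -/

theorem integral_eq_zero_of_periodic {E : Type*} [NormedAddCommGroup E] [NormedSpace ℝ E]
    [CompleteSpace E] {g g' : ℝ → E} (hg : ∀ x, HasDerivAt g (g' x) x) (hg' : Continuous g')
    (hgp : Function.Periodic g (2 * Real.pi)) : ∫ x in (0 : ℝ)..(2 * Real.pi), g' x = 0 := by
  rw [intervalIntegral.integral_eq_sub_of_hasDerivAt (fun x _ => hg x)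
    (hg'.intervalIntegrable _ _)]
  have := hgp 0
  rw [zero_add] at this
  rw [this, sub_self]

/-- The spectral gap: `h` is the support function of the unit curve, `μ = h (h + h'')`, and `α` is
orthogonal to the functions `[c, v]`. -/
theorem exists_spectral_gap {h μ : ℝ → ℝ} (hh : ContDiff ℝ ∞ h) (hμ : Continuous μ)
    (hpos : ∀ x, 0 < h x) (hμpos : ∀ x, 0 < μ x) (hper : Function.Periodic h Real.pi)
    (hμper : Function.Periodic μ Real.pi)
    (hh2 : ∀ x, HasDerivAt (deriv h) (μ x / h x - h x) x) :
    ∃ K, 0 < K ∧ ∀ α α' : ℝ → ℝ, (∀ x, HasDerivAt α (α' x) x) → Continuous α' →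
      Function.Antiperiodic α Real.pi →
      (∀ c : Plane, ∫ x in (0 : ℝ)..(2 * Real.pi),
        μ x * α x * ((h x)⁻¹ * bracket c (eTheta x)) = 0) →
      ∫ x in (0 : ℝ)..(2 * Real.pi), μ x * α x ^ 2 ≤
        K * ((∫ x in (0 : ℝ)..(2 * Real.pi), h x ^ 2 * α' x ^ 2) -
          ∫ x in (0 : ℝ)..(2 * Real.pi), μ x * α x ^ 2) := by
  have hpi := Real.two_pi_pos
  have hne : ∀ x, h x ≠ 0 := fun x => (hpos x).ne'
  have hhc : Continuous h := hh.continuous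
  have hhc' : Continuous (deriv h) := hh.deriv_infty.continuous
  have hic : Continuous fun x => (h x)⁻¹ := hhc.inv₀ hne
  obtain ⟨C, hC, hCb⟩ := exists_norm_le_of_periodic (f := fun x => μ x * (h x)⁻¹ ^ 2) (by fun_prop)
    Real.pi_pos (fun x => by simp only [hper x, hμper x])
  have hII : ∀ {g : ℝ → ℝ}, Continuous g → IntervalIntegrable g MeasureTheory.volume 0
      (2 * Real.pi) := fun hg => hg.intervalIntegrable _ _
  refine ⟨C / 3, by positivity, fun α α' hd hα' ha horth => ?_⟩
  have hα : Continuous α := continuous_iff_continuousAt.2 fun x => (hd x).continuousAt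
  have hhd := fun x => hh.hasDerivAt_deriv x
  obtain ⟨c, hc⟩ := exists_three_mul_integral_sq_le (q := fun x => h x * α x)
    (fun x => (hhd x).mul (hd x)) (by fun_prop) (fun x => by simp only [hper x, ha x]; ring)
  have hec : Continuous fun x => bracket c (eTheta x) :=
    continuous_const.bracket contDiff_eTheta.continuous
  -- The integrand is the derivative of `h h' α²`, because `h h'' = μ - h²`.
  have hz : ∫ x in (0 : ℝ)..(2 * Real.pi), ((deriv h x * α x + h x * α' x) ^ 2 - (h x * α x) ^ 2 -
      (h x ^ 2 * α' x ^ 2 - μ x * α x ^ 2)) = 0 := by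
    refine integral_eq_zero_of_periodic (g := fun x => h x * deriv h x * (α x * α x))
      (fun x => ?_) (by fun_prop) fun x => ?_
    · refine (((hhd x).mul (hh2 x)).mul ((hd x).mul (hd x))).congr_deriv ?_
      have := hne x
      simp only [Pi.mul_apply]
      field_simp; ring
    · have h1 : Function.Periodic h (2 * Real.pi) := hper.nat_mul 2
      simp only [h1 x, h1.deriv_of_periodic x, ha.periodic_two_mul x]
  rw [intervalIntegral.integral_sub (hII (by fun_prop)) (hII (by fun_prop)),
    sub_eq_zero] at hz
  rw [hz, intervalIntegral.integral_sub (hII (by fun_prop)) (hII (by fun_prop))] at hc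
  -- Pythagoras in the space weighted by `μ`: the cross term vanishes by orthogonality.
  have h1 : ∫ x in (0 : ℝ)..(2 * Real.pi), μ x * α x ^ 2 ≤ ∫ x in (0 : ℝ)..(2 * Real.pi),
      μ x * (α x - (h x)⁻¹ * bracket c (eTheta x)) ^ 2 := by
    have e : ∀ x, μ x * (α x - (h x)⁻¹ * bracket c (eTheta x)) ^ 2 = μ x * α x ^ 2 +
        (μ x * ((h x)⁻¹ * bracket c (eTheta x)) ^ 2 -
          2 * (μ x * α x * ((h x)⁻¹ * bracket c (eTheta x)))) := fun x => by ring
    simp only [e]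
    rw [intervalIntegral.integral_add (hII (by fun_prop)) (hII (by fun_prop)),
      intervalIntegral.integral_sub (hII (by fun_prop)) (hII (by fun_prop)),
      intervalIntegral.integral_const_mul, horth c]
    have : 0 ≤ ∫ x in (0 : ℝ)..(2 * Real.pi), μ x * ((h x)⁻¹ * bracket c (eTheta x)) ^ 2 :=
      intervalIntegral.integral_nonneg hpi.le fun x _ => by have := hμpos x; positivity
    linarith
  have h2 : ∫ x in (0 : ℝ)..(2 * Real.pi), μ x * (α x - (h x)⁻¹ * bracket c (eTheta x)) ^ 2 ≤
      ∫ x in (0 : ℝ)..(2 * Real.pi), C * (h x * α x - bracket c (eTheta x)) ^ 2 := by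
    refine intervalIntegral.integral_mono_on hpi.le (hII (by fun_prop)) (hII (by fun_prop))
      fun x _ => ?_
    have e : μ x * (α x - (h x)⁻¹ * bracket c (eTheta x)) ^ 2 =
        (μ x * (h x)⁻¹ ^ 2) * (h x * α x - bracket c (eTheta x)) ^ 2 := by
      have := hne x
      field_simp
    rw [e]
    have := (le_abs_self _).trans (hCb x)
    gcongr
  rw [intervalIntegral.integral_const_mul] at h2
  calc _ ≤ _ := h1
    _ ≤ _ := h2
    _ = C / 3 * (3 * ∫ x in (0 : ℝ)..(2 * Real.pi), (h x * α x - bracket c (eTheta x)) ^ 2) := by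
      ring
    _ ≤ _ := by gcongr

/-! ### Geometric decay of the curvature radii -/

/-- Over a half period `f` changes by `-2 f θ`. This turns integral bounds into uniform ones. -/
theorem abs_le_half_integral_of_antiperiodic {f f' : ℝ → ℝ} (hd : ∀ x, HasDerivAt f (f' x) x)
    (hf' : Continuous f') (ha : Function.Antiperiodic f Real.pi) (θ : ℝ) :
    |f θ| ≤ (1 / 2 : ℝ) * ∫ x in (0 : ℝ)..(2 * Real.pi), |f' x| := by
  have hpi := Real.pi_pos
  have ha' : Function.Antiperiodic f' Real.pi := by
    rw [show f' = deriv f from funext fun x => (hd x).deriv.symm]; exact ha.deriv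
  have hper : Function.Periodic (fun x => |f' x|) (2 * Real.pi) := fun x => by
    simp only [ha'.periodic_two_mul x]
  have h1 := intervalIntegral.integral_eq_sub_of_hasDerivAt (a := θ) (b := θ + Real.pi)
    (fun x _ => hd x) (hf'.intervalIntegrable _ _)
  rw [ha θ] at h1
  have h2 := intervalIntegral.abs_integral_le_integral_abs (f := f') (μ := MeasureTheory.volume)
    (a := θ) (b := θ + Real.pi) (by linarith)
  have h3 : ∫ x in θ..(θ + Real.pi), |f' x| ≤ ∫ x in θ..(θ + 2 * Real.pi), |f' x| := by
    refine intervalIntegral.integral_mono_interval le_rfl (by linarith) (by linarith)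
      (Eventually.of_forall fun x => abs_nonneg _) (hf'.abs.intervalIntegrable _ _)
  have h4 := hper.intervalIntegral_add_eq θ 0
  rw [zero_add] at h4
  rw [h1, show -f θ - f θ = -(2 * f θ) by ring, abs_neg, abs_mul, abs_two] at h2
  linarith

/-- Geometric decay of the curvature radii of the iterated involutes. -/
theorem exists_geometric_decay {h μ : ℝ → ℝ} (hh : ContDiff ℝ ∞ h) (hμ : Continuous μ)
    (hpos : ∀ x, 0 < h x) (hμpos : ∀ x, 0 < μ x) (hper : Function.Periodic h Real.pi)
    (hμper : Function.Periodic μ Real.pi)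
    (hh2 : ∀ x, HasDerivAt (deriv h) (μ x / h x - h x) x)
    {A B : ℕ → ℝ → ℝ} (hAc : ∀ i, Continuous (A i))
    (hB : ∀ i x, HasDerivAt (B i) (-(μ x * A i x)) x)
    (hA : ∀ i x, HasDerivAt (A (i + 1)) ((h x ^ 2)⁻¹ * B i x) x)
    (hAa : ∀ i, Function.Antiperiodic (A i) Real.pi)
    (hBa : ∀ i, Function.Antiperiodic (B i) Real.pi)
    (horth : ∀ i, ∀ c : Plane, ∫ x in (0 : ℝ)..(2 * Real.pi),
        μ x * A i x * ((h x)⁻¹ * bracket c (eTheta x)) = 0) :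
    ∃ s C, 0 < s ∧ s < 1 ∧ 0 < C ∧ ∀ i x, |A i x| ≤ C * s ^ i ∧ |B i x| ≤ C * s ^ i := by
  have hpi := Real.two_pi_pos
  have hne : ∀ x, h x ≠ 0 := fun x => (hpos x).ne'
  have hhc : Continuous h := hh.continuous
  have hνc : Continuous fun x => (h x ^ 2)⁻¹ := (hhc.pow 2).inv₀ fun x =>
    pow_ne_zero 2 (hne x)
  have hBc : ∀ i, Continuous (B i) := fun i =>
    continuous_iff_continuousAt.2 fun x => (hB i x).continuousAt
  have hII : ∀ {g : ℝ → ℝ}, Continuous g → IntervalIntegrable g MeasureTheory.volume 0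
      (2 * Real.pi) := fun hg => hg.intervalIntegrable _ _
  obtain ⟨K, hK, hgap⟩ := exists_spectral_gap hh hμ hpos hμpos hper hμper hh2
  set a : ℕ → ℝ := fun i => ∫ x in (0 : ℝ)..(2 * Real.pi), μ x * A i x ^ 2 with hadef
  set b : ℕ → ℝ := fun i => ∫ x in (0 : ℝ)..(2 * Real.pi), (h x ^ 2)⁻¹ * B i x ^ 2 with hbdef
  have ha0 : ∀ i, 0 ≤ a i := fun i => intervalIntegral.integral_nonneg hpi.le fun x _ => by
    have := hμpos x; positivity
  have h1 : ∀ i, a (i + 1) ≤ K * (b i - a (i + 1)) := fun i => by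
    have hAi := hAc (i + 1)
    have hBi := hBc i
    have := hgap _ _ (hA i) (by fun_prop) (hAa (i + 1)) (horth (i + 1))
    refine this.trans_eq ?_
    simp only [hadef, hbdef]
    congr 3
    funext x
    have := hne x
    field_simp
  have h2 : ∀ i, b i ≤ (a i + a (i + 1)) / 2 := fun i => by
    have hAi := hAc i
    have hAi' := hAc (i + 1)
    have hBi := hBc i
    have hz : ∫ x in (0 : ℝ)..(2 * Real.pi), ((h x ^ 2)⁻¹ * B i x ^ 2 -
        μ x * (A i x * A (i + 1) x)) = 0 := by
      refine integral_eq_zero_of_periodic (g := fun x => A (i + 1) x * B i x) (fun x => ?_)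
        (by fun_prop) fun x => ?_
      · refine ((hA i x).mul (hB i x)).congr_deriv ?_
        ring
      · simp only [(hAa (i + 1)).periodic_two_mul x, (hBa i).periodic_two_mul x]
    rw [intervalIntegral.integral_sub (hII (by fun_prop)) (hII (by fun_prop)),
      sub_eq_zero] at hz
    have hle : ∫ x in (0 : ℝ)..(2 * Real.pi), μ x * (A i x * A (i + 1) x) ≤
        ∫ x in (0 : ℝ)..(2 * Real.pi), (1 / 2 : ℝ) * (μ x * A i x ^ 2 + μ x * A (i + 1) x ^ 2) := by
      refine intervalIntegral.integral_mono_on hpi.le (hII (by fun_prop)) (hII (by fun_prop))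
        fun x _ => ?_
      have := mul_nonneg (hμpos x).le (sq_nonneg (A i x - A (i + 1) x))
      linarith
    rw [intervalIntegral.integral_const_mul,
      intervalIntegral.integral_add (hII (by fun_prop)) (hII (by fun_prop)), ← hz] at hle
    simp only [hadef, hbdef]
    linarith
  -- Eliminating `b i` from `h1` and `h2` leaves `(K + 2) a (i + 1) ≤ K a i`.
  set q := K / (K + 2) with hq
  have hq0 : 0 < q := by positivity
  have hq1 : q < 1 := by rw [hq, div_lt_one (by positivity)]; linarith
  have h3 : ∀ i, a (i + 1) ≤ q * a i := fun i => by
    rw [hq, div_mul_eq_mul_div, le_div_iff₀ (by positivity)]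
    have := mul_le_mul_of_nonneg_left (h2 i) hK.le
    have := h1 i
    linarith
  have h4 : ∀ i, a i ≤ a 0 * q ^ i := fun i => by
    induction i with
    | zero => simp
    | succ i ih =>
      calc _ ≤ _ := h3 i
        _ ≤ q * (a 0 * q ^ i) := by gcongr
        _ = _ := by ring
  -- The quantities `a i` are quadratic, so the functions themselves decay at the rate `√q`.
  set s := √q with hs
  have hs0 : 0 < s := Real.sqrt_pos.2 hq0
  have hs1 : s < 1 := by rw [hs, Real.sqrt_lt' one_pos]; simpa using hq1
  have hsq : s ^ 2 = q := Real.sq_sqrt hq0.le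
  obtain ⟨C₁, hC₁, hb₁⟩ := exists_norm_le_of_periodic hμ Real.pi_pos hμper
  obtain ⟨C₂, hC₂, hb₂⟩ := exists_norm_le_of_periodic hνc Real.pi_pos
    (fun x => by simp only [hper x])
  obtain ⟨C₃, hC₃, hb₃⟩ := exists_norm_le_of_periodic (hAc 0) hpi (hAa 0).periodic_two_mul
  set D := 2 * Real.pi * C₁ + a 0 with hD
  have hDpos : 0 < D := by have := ha0 0; positivity
  have h5 : ∀ i x, |B i x| ≤ D * s ^ i := fun i x => by
    have hAi := hAc i
    have hsi : 0 < s ^ i := pow_pos hs0 i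
    refine (abs_le_half_integral_of_antiperiodic (hB i) (by fun_prop) (hBa i) x).trans ?_
    have hle : ∫ x in (0 : ℝ)..(2 * Real.pi), |-(μ x * A i x)| ≤
        ∫ x in (0 : ℝ)..(2 * Real.pi), (C₁ * s ^ i + (s ^ i)⁻¹ * (μ x * A i x ^ 2)) := by
      refine intervalIntegral.integral_mono_on hpi.le (hII (by fun_prop)) (hII (by fun_prop))
        fun x _ => ?_
      have hμx := hμpos x
      rw [abs_neg, abs_mul, abs_of_pos hμx]
      -- The weight `s ^ i` makes both terms of order `s ^ i` after integration.
      have e1 : |A i x| ≤ s ^ i + (s ^ i)⁻¹ * A i x ^ 2 := by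
        have e2 : 0 ≤ (s ^ i)⁻¹ * (|A i x| - s ^ i) ^ 2 := by positivity
        have e3 : (s ^ i)⁻¹ * (|A i x| - s ^ i) ^ 2 =
            (s ^ i)⁻¹ * A i x ^ 2 - 2 * |A i x| + s ^ i := by
          rw [sub_sq, sq_abs]; field_simp
        have := abs_nonneg (A i x)
        linarith
      calc μ x * |A i x| ≤ μ x * (s ^ i + (s ^ i)⁻¹ * A i x ^ 2) := by gcongr
        _ = μ x * s ^ i + (s ^ i)⁻¹ * (μ x * A i x ^ 2) := by ring
        _ ≤ _ := by
          have := (le_abs_self _).trans (hb₁ x)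
          gcongr
    rw [intervalIntegral.integral_add (hII (by fun_prop)) (hII (by fun_prop)),
      intervalIntegral.integral_const, intervalIntegral.integral_const_mul, smul_eq_mul,
      sub_zero] at hle
    have e4 : (s ^ i)⁻¹ * a i ≤ a 0 * s ^ i := by
      rw [inv_mul_le_iff₀ hsi]
      refine (h4 i).trans_eq ?_
      rw [← hsq]; ring
    have e5 : 0 ≤ a 0 * s ^ i := mul_nonneg (ha0 0) hsi.le
    have e6 : 0 < C₁ * s ^ i := by positivity
    have e7 : 0 < 2 * Real.pi * (C₁ * s ^ i) := by positivity
    rw [hD]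
    calc _ ≤ 1 / 2 * (2 * Real.pi * (C₁ * s ^ i) + a 0 * s ^ i) := by gcongr; linarith
      _ ≤ _ := by linarith
  have h6 : ∀ i x, |A (i + 1) x| ≤ (Real.pi * C₂ * D) * s ^ i := fun i x => by
    have hBi := hBc i
    refine (abs_le_half_integral_of_antiperiodic (hA i) (by fun_prop) (hAa (i + 1)) x).trans ?_
    have hle : ∫ x in (0 : ℝ)..(2 * Real.pi), |(h x ^ 2)⁻¹ * B i x| ≤
        ∫ x in (0 : ℝ)..(2 * Real.pi), C₂ * (D * s ^ i) := by
      refine intervalIntegral.integral_mono_on hpi.le (hII (by fun_prop)) (hII (by fun_prop))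
        fun x _ => ?_
      rw [abs_mul]
      exact mul_le_mul (hb₂ x) (h5 i x) (abs_nonneg _) hC₂.le
    rw [intervalIntegral.integral_const, smul_eq_mul, sub_zero] at hle
    linarith
  have hpi' := Real.pi_pos
  refine ⟨s, D + C₃ + Real.pi * C₂ * D / s, hs0, hs1, by positivity, fun i x => ⟨?_, ?_⟩⟩
  · cases i with
    | zero =>
      have := hb₃ x
      rw [Real.norm_eq_abs] at this
      have : 0 < Real.pi * C₂ * D / s := by positivity
      simp only [pow_zero, mul_one]
      linarith
    | succ i =>
      refine (h6 i x).trans ?_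
      have e : Real.pi * C₂ * D * s ^ i = Real.pi * C₂ * D / s * s ^ (i + 1) := by
        rw [pow_succ]; field_simp
      rw [e]
      gcongr
      linarith
  · refine (h5 i x).trans ?_
    have : 0 < Real.pi * C₂ * D / s := by positivity
    gcongr
    linarith

/-! ### Decay of all derivatives and convergence of curves -/

section Decay

variable {E : Type*} [NormedAddCommGroup E] [NormedSpace ℝ E]

/-- The first `n` derivatives of the functions `F i` are `O(s ^ i)`, uniformly. -/
def GeometricDecay (s : ℝ) : ℕ → (ℕ → ℝ → E) → Prop
  | 0, F => ∃ C, ∀ i x, ‖F i x‖ ≤ C * s ^ i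
  | n + 1, F => (∃ C, ∀ i x, ‖F i x‖ ≤ C * s ^ i) ∧ GeometricDecay s n fun i => deriv (F i)

namespace GeometricDecay

variable {s : ℝ} {n : ℕ}

theorem bound {F : ℕ → ℝ → E} (h : GeometricDecay s n F) : ∃ C, ∀ i x, ‖F i x‖ ≤ C * s ^ i := by
  cases n with
  | zero => exact h
  | succ n => exact h.1

theorem of_succ : ∀ {n : ℕ} {F : ℕ → ℝ → E}, GeometricDecay s (n + 1) F → GeometricDecay s n F
  | 0, _, h => h.1
  | _ + 1, _, h => ⟨h.1, of_succ h.2⟩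

theorem add : ∀ {n : ℕ} {F G : ℕ → ℝ → E}, (∀ i, ContDiff ℝ ∞ (F i)) → (∀ i, ContDiff ℝ ∞ (G i)) →
    GeometricDecay s n F → GeometricDecay s n G → GeometricDecay s n fun i x => F i x + G i x := by
  intro n
  induction n with
  | zero =>
    rintro F G - - ⟨C, hC⟩ ⟨D, hD⟩
    exact ⟨C + D, fun i x => (norm_add_le _ _).trans (by linarith [hC i x, hD i x])⟩
  | succ n ih =>
    rintro F G hF hG ⟨⟨C, hC⟩, hF'⟩ ⟨⟨D, hD⟩, hG'⟩
    refine ⟨⟨C + D, fun i x => (norm_add_le _ _).trans (by linarith [hC i x, hD i x])⟩, ?_⟩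
    have e : (fun i => deriv fun x => F i x + G i x) =
        fun i x => deriv (F i) x + deriv (G i) x := by
      funext i x
      exact (((hF i).hasDerivAt_deriv x).add ((hG i).hasDerivAt_deriv x)).deriv
    rw [e]
    exact ih (fun i => (hF i).deriv_infty) (fun i => (hG i).deriv_infty) hF' hG'

theorem smul : ∀ {n : ℕ} {F : ℕ → ℝ → ℝ} {G : ℝ → E}, (∀ i, ContDiff ℝ ∞ (F i)) →
    ContDiff ℝ ∞ G → Function.Periodic G (2 * Real.pi) → GeometricDecay s n F →
    GeometricDecay s n fun i x => F i x • G x := by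
  intro n
  induction n with
  | zero =>
    rintro F G - hG hper ⟨C, hC⟩
    obtain ⟨D, hD, hGD⟩ := exists_norm_le_of_periodic hG.continuous Real.two_pi_pos hper
    refine ⟨C * D, fun i x => ?_⟩
    rw [norm_smul, mul_right_comm]
    exact mul_le_mul (hC i x) (hGD x) (norm_nonneg _) ((norm_nonneg _).trans (hC i x))
  | succ n ih =>
    rintro F G hF hG hper ⟨⟨C, hC⟩, hF'⟩
    obtain ⟨D, hD, hGD⟩ := exists_norm_le_of_periodic hG.continuous Real.two_pi_pos hper
    refine ⟨⟨C * D, fun i x => ?_⟩, ?_⟩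
    · rw [norm_smul, mul_right_comm]
      exact mul_le_mul (hC i x) (hGD x) (norm_nonneg _) ((norm_nonneg _).trans (hC i x))
    have e : (fun i => deriv fun x => F i x • G x) =
        fun i x => F i x • deriv G x + deriv (F i) x • G x := by
      funext i x
      exact (((hF i).hasDerivAt_deriv x).smul (hG.hasDerivAt_deriv x)).deriv
    rw [e]
    refine add (fun i => (hF i).smul hG.deriv_infty) (fun i => (hF i).deriv_infty.smul hG)
      (ih hF hG.deriv_infty hper.deriv_of_periodic ?_)
      (ih (fun i => (hF i).deriv_infty) hG hper hF')
    exact of_succ (F := F) ⟨⟨C, hC⟩, hF'⟩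

/-- The recursion gives no formula for the derivative of `A 0`; a single smooth periodic function
only enlarges the constants. -/
theorem of_tail (hs : 0 < s) : ∀ {n : ℕ} {F : ℕ → ℝ → E}, ContDiff ℝ ∞ (F 0) →
    Function.Periodic (F 0) (2 * Real.pi) → GeometricDecay s n (fun i => F (i + 1)) →
    GeometricDecay s n F := by
  have key : ∀ {F : ℕ → ℝ → E}, ContDiff ℝ ∞ (F 0) → Function.Periodic (F 0) (2 * Real.pi) →
      (∃ C, ∀ i x, ‖F (i + 1) x‖ ≤ C * s ^ i) → ∃ C, ∀ i x, ‖F i x‖ ≤ C * s ^ i := by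
    rintro F h0 hper ⟨C, hC⟩
    obtain ⟨D, hD, hFD⟩ := exists_norm_le_of_periodic h0.continuous Real.two_pi_pos hper
    refine ⟨max D (C / s), fun i x => ?_⟩
    cases i with
    | zero => simpa using Or.inl (hFD x)
    | succ i =>
      refine (hC i x).trans ?_
      calc C * s ^ i = C / s * s ^ (i + 1) := by rw [pow_succ]; field_simp
        _ ≤ _ := by gcongr; exact le_max_right _ _
  intro n
  induction n with
  | zero => intro F h0 hper h; exact key h0 hper h
  | succ n ih =>
    intro F h0 hper h
    exact ⟨key h0 hper h.1, ih h0.deriv_infty hper.deriv_of_periodic h.2⟩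

theorem iteratedDeriv_bound : ∀ {n : ℕ} {F : ℕ → ℝ → E}, GeometricDecay s n F →
    ∃ C, ∀ i x, ‖iteratedDeriv n (F i) x‖ ≤ C * s ^ i
  | 0, F, h => by simpa using h.bound
  | n + 1, F, h => by simpa only [iteratedDeriv_succ'] using iteratedDeriv_bound h.2

end GeometricDecay

end Decay

theorem tendstoUniformly_of_geometric_bound {E : Type*} [NormedAddCommGroup E]
    {F : ℕ → ℝ → E} {f : ℝ → E} {s C : ℝ} (hs : 0 ≤ s)
    (hs1 : s < 1) (h : ∀ i x, ‖F i x - f x‖ ≤ C * s ^ i) : TendstoUniformly F f atTop := by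
  rw [Metric.tendstoUniformly_iff]
  intro ε hε
  have h1 : Tendsto (fun i => C * s ^ i) atTop (𝓝 0) := by
    simpa using (tendsto_pow_atTop_nhds_zero_of_lt_one hs hs1).const_mul C
  filter_upwards [h1.eventually (gt_mem_nhds hε)] with i hi x
  rw [dist_comm, dist_eq_norm]
  exact (h i x).trans_lt hi

theorem CInftyConverges.of_geometricDecay {X : ℕ → ℝ → Plane} {O : Plane} {s C : ℝ} (hs : 0 ≤ s)
    (hs1 : s < 1) (hX : ∀ i, ContDiff ℝ ∞ (X i)) (h0 : ∀ i x, ‖X i x - O‖ ≤ C * s ^ i)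
    (hd : ∀ n, GeometricDecay s n fun i => deriv (X i)) : CInftyConverges X fun _ => O := by
  refine ⟨hX, contDiff_const, fun k => ?_⟩
  cases k with
  | zero =>
    simpa only [iteratedDeriv_zero] using tendstoUniformly_of_geometric_bound hs hs1 h0
  | succ k =>
    obtain ⟨D, hD⟩ := (hd k).iteratedDeriv_bound
    refine tendstoUniformly_of_geometric_bound (C := D) hs hs1 fun i x => ?_
    simpa [iteratedDeriv_succ', deriv_const', iteratedDeriv_const] using hD i x

theorem CInftyConverges.add_curve {X : ℕ → ℝ → Plane} {O : Plane}
    (h : CInftyConverges X fun _ => O) {U : ℝ → Plane} (hU : ContDiff ℝ ∞ U) :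
    CInftyConverges (fun i θ => X i θ + U θ) fun θ => O + U θ := by
  refine ⟨fun i => (h.1 i).add hU, contDiff_const.add hU, fun k => ?_⟩
  have hk : ∀ {f : ℝ → Plane}, ContDiff ℝ ∞ f → ∀ x, ContDiffAt ℝ k f x := fun hf x =>
    (hf.of_le (by exact_mod_cast le_top)).contDiffAt
  have e : ∀ Y : ℝ → Plane, ContDiff ℝ ∞ Y → iteratedDeriv k (fun θ => Y θ + U θ) =
      fun x => iteratedDeriv k Y x + iteratedDeriv k U x := fun Y hY => by
    funext x
    exact iteratedDeriv_fun_add (hk hY x) (hk hU x)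
  have h1 := h.2.2 k
  rw [Metric.tendstoUniformly_iff] at h1 ⊢
  intro ε hε
  filter_upwards [h1 ε hε] with i hi x
  rw [e _ (h.1 i), e _ contDiff_const]
  simpa using hi x

/-! ### The limit point and the cross sets -/

/-- Near the limit, `[p - X i, z]` is close to `[p - O, z]`, which crosses once. Uniform convergence
of `X i` suffices, since no derivative of `X i` enters. -/
theorem IsFront.exists_mem_crossSet {z : ℝ → Plane} {X : ℕ → ℝ → Plane} {O p : Plane}
    (h : ∀ i, IsFront z (X i)) (hlim : TendstoUniformly X (fun _ => O) atTop) (hp : p ≠ O) :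
    ∃ i, p ∈ crossSet z (X i) := by
  have hpO : p - O ≠ 0 := sub_ne_zero.2 hp
  have hz := (h 0).smooth_dir
  have hd : ∀ θ, HasDerivAt (fun θ => bracket (p - O) (z θ)) (bracket (p - O) (deriv z θ)) θ :=
    fun θ => ((hasDerivAt_const θ (p - O)).bracket (hz.hasDerivAt_deriv θ)).congr_deriv (by simp)
  obtain ⟨ε, hε, H⟩ := ((h 0).crosses _ hpO).exists_perturb hd
    (continuous_const.bracket hz.deriv_infty.continuous)
  obtain ⟨C, hC, hb⟩ := (h 0).exists_bound
  rw [Metric.tendstoUniformly_iff] at hlim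
  obtain ⟨i, hi⟩ := (hlim (ε / (2 * C)) (by positivity)).exists
  have key : ∀ (θ : ℝ) (w : Plane), ‖w‖ ≤ C →
      |bracket (p - X i θ) w - bracket (p - O) w| < ε := fun θ w hw => by
    rw [← bracket_sub_left, sub_sub_sub_cancel_left]
    have h1 := hi θ
    rw [dist_eq_norm, lt_div_iff₀ (by positivity)] at h1
    calc _ ≤ 2 * ‖O - X i θ‖ * ‖w‖ := abs_bracket_le _ _
      _ ≤ 2 * ‖O - X i θ‖ * C := by gcongr
      _ < ε := by linarith
  refine ⟨i, H _ _ ?_ ?_ (fun θ => key θ _ (hb θ).2.1) fun θ => key θ _ (hb θ).2.2⟩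
  · simpa only [one_smul] using (h i).antiperiodic p 1
  · simpa only [one_smul] using (h i).hasDerivAt p 1

/-- Otherwise a late curve would enter this open set, and by monotonicity its own cross set, which
it avoids. -/
theorem IsFront.limit_notMem_crossSet {z : ℝ → Plane} {X : ℕ → ℝ → Plane} {O : Plane}
    (h : ∀ i, IsFront z (X i)) (hlim : TendstoUniformly X (fun _ => O) atTop)
    (hmono : Monotone fun i => crossSet z (X i)) (i : ℕ) : O ∉ crossSet z (X i) := by
  intro hO
  have h0 : Tendsto (fun j => X j 0) atTop (𝓝 O) := hlim.tendsto_at 0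
  obtain ⟨j, hj, hij⟩ := ((h0.eventually ((h i).isOpen_crossSet.mem_nhds hO)).and
    (eventually_ge_atTop i)).exists
  exact (h j).disjoint_range (hmono hij hj) (mem_range_self 0)

/-- Limit of a sequence of curves with geometrically small increments and velocities. -/
theorem exists_limit_of_geometric_bound {X : ℕ → ℝ → Plane} {s C D : ℝ} (hs : 0 ≤ s) (hs1 : s < 1)
    (hX : ∀ i, Differentiable ℝ (X i)) (hstep : ∀ i x, ‖X (i + 1) x - X i x‖ ≤ C * s ^ i)
    (hder : ∀ i x, ‖deriv (X i) x‖ ≤ D * s ^ i) :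
    ∃ O : Plane, ∀ i x, ‖X i x - O‖ ≤ C / (1 - s) * s ^ i := by
  have hdist : ∀ x i, dist (X i x) (X (i + 1) x) ≤ C * s ^ i := fun x i => by
    rw [dist_comm, dist_eq_norm]; exact hstep i x
  choose l hl using fun x => cauchySeq_tendsto_of_complete
    (cauchySeq_of_le_geometric s C hs1 (hdist x))
  have hconst : ∀ x, l x = l 0 := fun x => by
    have h1 : Tendsto (fun i => X i x - X i 0) atTop (𝓝 (l x - l 0)) := (hl x).sub (hl 0)
    have h2 : Tendsto (fun i => X i x - X i 0) atTop (𝓝 0) := by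
      have h3 : Tendsto (fun i => D * s ^ i * ‖x - 0‖) atTop (𝓝 0) := by
        simpa using ((tendsto_pow_atTop_nhds_zero_of_lt_one hs hs1).const_mul D).mul_const ‖x - 0‖
      refine squeeze_zero_norm (fun i => ?_) h3
      exact Convex.norm_image_sub_le_of_norm_deriv_le (s := univ) (fun y _ => hX i y)
        (fun y _ => hder i y) convex_univ (mem_univ _) (mem_univ _)
    exact sub_eq_zero.1 (tendsto_nhds_unique h1 h2)
  refine ⟨l 0, fun i x => ?_⟩
  have := dist_le_of_le_geometric_of_tendsto s C hs1 (hdist x) (hl x) i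
  rw [hconst x, dist_eq_norm] at this
  refine this.trans_eq ?_
  ring

end MinkowskiPlane

/-! ### The main theorem -/

open MinkowskiPlane in
theorem mainTheorem1 (γ u v : ℝ → MinkowskiPlane.Plane)
    (hγ : MinkowskiPlane.IsConvexCurve γ)
    (hu : ∃ k : ℝ, 0 < k ∧ ∀ θ, u θ = k • MinkowskiPlane.symmetrization γ θ)
    (hv : v = MinkowskiPlane.dualCurve u)
    (M N : ℕ → ℝ → MinkowskiPlane.Plane)
    (hM0 : M 0 = MinkowskiPlane.areaEvolute γ)
    (hN : ∀ i, N (i + 1) = MinkowskiPlane.involute u (M i))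
    (hM : ∀ i, M (i + 1) = MinkowskiPlane.involute v (N (i + 1))) :
    (∀ i, MinkowskiPlane.boundedRegion γ (N (i + 1)) ⊆ MinkowskiPlane.boundedRegion γ (M i) ∧
      MinkowskiPlane.boundedRegion γ (M (i + 1)) ⊆
        MinkowskiPlane.boundedRegion γ (N (i + 1))) ∧
    ∃ O : MinkowskiPlane.Plane,
      (⋂ i, MinkowskiPlane.boundedRegion γ (M i) ∩
        MinkowskiPlane.boundedRegion γ (N (i + 1))) = {O} ∧
      MinkowskiPlane.CInftyConverges M (fun _ => O) ∧
      MinkowskiPlane.CInftyConverges (fun i => N (i + 1)) (fun _ => O) ∧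
      ∀ c d : ℝ,
        (∀ i, MinkowskiPlane.HasConstantWidth u c (fun θ => M i θ + c • u θ)) ∧
        (∀ i, MinkowskiPlane.HasConstantWidth v d (fun θ => N (i + 1) θ + d • v θ)) ∧
        MinkowskiPlane.CInftyConverges (fun i θ => M i θ + c • u θ) (fun θ => O + c • u θ) ∧
        MinkowskiPlane.CInftyConverges (fun i θ => N (i + 1) θ + d • v θ)
          (fun θ => O + d • v θ) := by
  obtain ⟨ρ, hud, hpos, hveq, hpair, hfront, hrange⟩ := hγ.exists_dualPair hu
  rw [← hM0, ← hv] at hfront hrange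
  rw [← hv] at hpair hveq
  set h := supportFun u with hh
  set μ : ℝ → ℝ := fun θ => ρ θ * h θ with hμ
  have hswap := hpair.swap
  have hMF : ∀ i, IsFront v (M i) := fun i => by
    induction i with
    | zero => exact hfront
    | succ i ih =>
      have h1 := hpair.isFront_involute ih
      rw [← hN] at h1
      have h2 := hswap.isFront_involute h1
      rw [← hM] at h2
      exact h2.neg_dir
  -- The curves `N` start at index `1`; `N 0` is arbitrary.
  have hNF : ∀ i, IsFront (fun θ => -u θ) (N (i + 1)) := fun i => by
    rw [hN]; exact hpair.isFront_involute (hMF i)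
  have hMN : ∀ i, crossSet v (M i) ⊆ crossSet (fun θ => -u θ) (N (i + 1)) := fun i => by
    rw [hN]; exact hpair.crossSet_subset_crossSet_involute (hMF i)
  have hNM : ∀ i, crossSet (fun θ => -u θ) (N (i + 1)) ⊆ crossSet v (M (i + 1)) := fun i => by
    have h2 := hswap.isFront_involute (hNF i)
    refine Set.Subset.trans ?_ (crossSet_neg_dir (by rw [hM]; exact h2))
    rw [hM]
    exact hswap.crossSet_subset_crossSet_involute (hNF i)
  have hmono : Monotone fun i => crossSet v (M i) :=
    monotone_nat_of_le_succ fun i => (hMN i).trans (hNM i)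
  have hγM : ∀ i, Set.range γ ⊆ crossSet v (M i) := fun i => hrange.trans (hmono (Nat.zero_le i))
  have hextM : ∀ i, boundedRegion γ (M i) = (crossSet v (M i))ᶜ := fun i => by
    rw [boundedRegion, (hMF i).exteriorOf_eq (hγM i)]
  have hextN : ∀ i, boundedRegion γ (N (i + 1)) = (crossSet (fun θ => -u θ) (N (i + 1)))ᶜ :=
    fun i => by rw [boundedRegion, (hNF i).exteriorOf_eq ((hγM i).trans (hMN i))]
  -- the curvature radii and their decay
  set A : ℕ → ℝ → ℝ := fun i => curvatureRadius u (M i) with hAdef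
  set B : ℕ → ℝ → ℝ := fun i => involuteRadius u (M i) with hBdef
  have hAsm : ∀ i, ContDiff ℝ ∞ (A i) := fun i => hpair.contDiff_curvatureRadius (hMF i)
  have hBsm : ∀ i, ContDiff ℝ ∞ (B i) := fun i => hpair.contDiff_involuteRadius (hMF i)
  have hAa : ∀ i, Function.Antiperiodic (A i) Real.pi :=
    fun i => hpair.antiperiodic_curvatureRadius (hMF i)
  have hBa : ∀ i, Function.Antiperiodic (B i) Real.pi :=
    fun i => hpair.antiperiodic_involuteRadius (hMF i)
  have hBd : ∀ i x, HasDerivAt (B i) (-(μ x * A i x)) x :=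
    fun i => hpair.hasDerivAt_involuteRadius (hMF i)
  have hNB : ∀ i, curvatureRadius v (N (i + 1)) = B i := fun i => by
    rw [hN]; exact hpair.curvatureRadius_involute (hMF i)
  have hMd : ∀ i x, deriv (M i) x = A i x • deriv u x :=
    fun i x => hpair.deriv_eq_curvatureRadius_smul (hMF i) x
  have hNd : ∀ i x, deriv (N (i + 1)) x = B i x • deriv v x := fun i x => by
    rw [hN]; exact hpair.deriv_involute (hMF i) x
  -- The sign appears because the dual of `v` is `-u`, while `A` is measured against `u`.
  have hA' : ∀ i x, A (i + 1) x = -involuteRadius v (N (i + 1)) x := fun i x => by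
    refine curvatureRadius_eq (by rw [hpair.bracket_deriv]; exact (hpair.pos x).ne') ?_
    rw [hM, hswap.deriv_involute (hNF i), show (fun θ => -u θ) = -u from rfl, deriv.neg]
    module
  have hAd : ∀ i x, HasDerivAt (A (i + 1)) ((h x ^ 2)⁻¹ * B i x) x := fun i x => by
    rw [show A (i + 1) = fun x => -involuteRadius v (N (i + 1)) x from funext (hA' i)]
    refine (hswap.hasDerivAt_involuteRadius (hNF i) x).neg.congr_deriv ?_
    rw [hNB, neg_neg]
  have hNeq : ∀ i x, N (i + 1) x = M i x + B i x • v x := fun i x => by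
    rw [hN, hpair.involute_eq]
  have hMeq : ∀ i x, M (i + 1) x = N (i + 1) x + A (i + 1) x • u x := fun i x => by
    rw [hA', hM, hswap.involute_eq]; module
  have husm := hpair.smooth
  have hvsm := hpair.smooth_dual
  have hua := hpair.antiperiodic
  have hva := hpair.antiperiodic_dual
  have hhsm : ContDiff ℝ ∞ h := contDiff_supportFun husm
  have hhper : Function.Periodic h Real.pi := periodic_supportFun hua
  have hμsm : ContDiff ℝ ∞ μ := hpair.smooth_weight
  have hμper : Function.Periodic μ Real.pi := hpair.periodic_weight
  obtain ⟨s, C, hs, hs1, hC, hdecay⟩ := exists_geometric_decay hhsm hμsm.continuous hpos hpair.pos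
    hhper hμper (fun x => by
      have := hasDerivAt_deriv_supportFun hud x
      rwa [hμ, mul_div_cancel_right₀ _ (hpos x).ne']) (fun i => (hAsm i).continuous) hBd hAd hAa hBa
    -- Orthogonality to `[c, v]` is the closedness of `M i`, as `[c, M i]' = μ A i [c, v]`.
    (fun i c => integral_eq_zero_of_periodic (g := fun x => bracket c (M i x))
      (fun x => by
        refine ((hasDerivAt_const x c).bracket ((hMF i).smooth.hasDerivAt_deriv x)).congr_deriv ?_
        rw [hMd, hpair.deriv_eq, hveq]
        simp; ring)
      (by
        have := contDiff_eTheta.continuous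
        have h1 := (hAsm i).continuous
        have h2 := hhsm.continuous.inv₀ fun x => (hpos x).ne'
        have h3 := (continuous_const (y := c)).bracket this
        exact (hμsm.continuous.mul h1).mul (h2.mul h3))
      fun x => by
        have : Function.Periodic (M i) (2 * Real.pi) := (hMF i).periodic.nat_mul 2
        simp only [this x])
  have hνsm : ContDiff ℝ ∞ fun x => (h x ^ 2)⁻¹ :=
    (hhsm.pow 2).inv fun x => pow_ne_zero 2 (hpos x).ne'
  -- The induction is joint: each derivative of one sequence is a fixed smooth periodic multiple of
  -- the other.
  have hGD : ∀ n, GeometricDecay s n A ∧ GeometricDecay s n B := fun n => by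
    induction n with
    | zero => exact ⟨⟨C, fun i x => (hdecay i x).1⟩, ⟨C, fun i x => (hdecay i x).2⟩⟩
    | succ n ih =>
      constructor
      · refine GeometricDecay.of_tail hs (hAsm 0) (hAa 0).periodic_two_mul ⟨⟨C, fun i x => ?_⟩, ?_⟩
        · refine ((hdecay (i + 1) x).1).trans ?_
          rw [pow_succ]
          have : C * s ^ i * s ≤ C * s ^ i * 1 := by gcongr
          linarith
        · have e : (fun i => deriv (A (i + 1))) = fun i x => B i x • (h x ^ 2)⁻¹ := by
            funext i x; rw [(hAd i x).deriv, smul_eq_mul, mul_comm]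
          rw [e]
          exact ih.2.smul hBsm hνsm (fun x => by
            simp only [(show Function.Periodic h (2 * Real.pi) from hhper.nat_mul 2) x])
      · refine ⟨⟨C, fun i x => (hdecay i x).2⟩, ?_⟩
        have e : (fun i => deriv (B i)) = fun i x => A i x • -μ x := by
          funext i x; rw [(hBd i x).deriv, smul_eq_mul]; ring
        rw [e]
        exact ih.1.smul hAsm hμsm.neg (fun x => by
          simp only [(show Function.Periodic μ (2 * Real.pi) from hμper.nat_mul 2) x])
  have hMGD : ∀ n, GeometricDecay s n fun i => deriv (M i) := fun n => by
    rw [show (fun i => deriv (M i)) = fun i x => A i x • deriv u x from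
      funext fun i => funext (hMd i)]
    exact (hGD n).1.smul hAsm husm.deriv_infty hua.deriv.periodic_two_mul
  have hNGD : ∀ n, GeometricDecay s n fun i => deriv (N (i + 1)) := fun n => by
    rw [show (fun i => deriv (N (i + 1))) = fun i x => B i x • deriv v x from
      funext fun i => funext (hNd i)]
    exact (hGD n).2.smul hBsm hvsm.deriv_infty hva.deriv.periodic_two_mul
  obtain ⟨U, hU, hUb⟩ := exists_norm_le_of_periodic husm.continuous Real.two_pi_pos
    hua.periodic_two_mul
  obtain ⟨V, hV, hVb⟩ := exists_norm_le_of_periodic hvsm.continuous Real.two_pi_pos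
    hva.periodic_two_mul
  have hBv : ∀ i x, ‖B i x • v x‖ ≤ C * V * s ^ i := fun i x => by
    rw [norm_smul, mul_right_comm]
    exact mul_le_mul (hdecay i x).2 (hVb x) (norm_nonneg _) (by positivity)
  have hAu : ∀ i x, ‖A i x • u x‖ ≤ C * U * s ^ i := fun i x => by
    rw [norm_smul, mul_right_comm]
    exact mul_le_mul (hdecay i x).1 (hUb x) (norm_nonneg _) (by positivity)
  obtain ⟨D, hD⟩ := (hMGD 0).bound
  obtain ⟨O, hO⟩ := exists_limit_of_geometric_bound (C := C * V + C * U) hs.le hs1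
    (fun i => (hMF i).smooth.differentiable (by simp)) (fun i x => by
      rw [hMeq, hNeq, add_assoc, add_sub_cancel_left]
      refine (norm_add_le _ _).trans ?_
      have h1 : C * U * s ^ (i + 1) ≤ C * U * s ^ i := by
        have := pow_le_pow_of_le_one hs.le hs1.le (Nat.le_succ i)
        gcongr
      linarith [hBv i x, hAu (i + 1) x]) hD
  have hMlim := tendstoUniformly_of_geometric_bound (f := fun _ => O) hs.le hs1 hO
  have hMC : CInftyConverges M fun _ => O :=
    CInftyConverges.of_geometricDecay hs.le hs1 (fun i => (hMF i).smooth) hO hMGD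
  have hNC : CInftyConverges (fun i => N (i + 1)) fun _ => O := by
    refine CInftyConverges.of_geometricDecay (C := (C * V + C * U) / (1 - s) + C * V) hs.le hs1
      (fun i => (hNF i).smooth) (fun i x => ?_) hNGD
    rw [hNeq, add_sub_right_comm]
    refine (norm_add_le _ _).trans ?_
    linarith [hO i x, hBv i x]
  refine ⟨fun i => ⟨?_, ?_⟩, O, ?_, hMC, hNC, fun c d => ⟨fun i θ => ?_, fun i θ => ?_,
    hMC.add_curve (husm.const_smul c), hNC.add_curve (hvsm.const_smul d)⟩⟩
  · rw [hextM, hextN]; exact Set.compl_subset_compl.2 (hMN i)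
  · rw [hextM, hextN]; exact Set.compl_subset_compl.2 (hNM i)
  · ext p
    simp only [hextM, hextN, Set.mem_iInter, Set.mem_inter_iff, Set.mem_compl_iff,
      Set.mem_singleton_iff]
    constructor
    · intro hp
      by_contra hne
      obtain ⟨i, hi⟩ := IsFront.exists_mem_crossSet hMF hMlim hne
      exact (hp i).1 hi
    · rintro rfl i
      have := IsFront.limit_notMem_crossSet hMF hMlim hmono
      exact ⟨this i, fun hi => this (i + 1) (hNM i hi)⟩
  · simp only [(hMF i).periodic θ, hua θ]
    module
  · simp only [(hNF i).periodic θ, hva θ]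
    module
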